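/- **Setting.** Let $n_1=2f_1+k$, $n_2=2f_2+d$ with $f_1<n_1/2$, $f_2<n_2/3$, $k\le d$. The system consists of writers $\mathcal W$ (with totally ordered ids), readers $\mathcal R$, edge servers $\mathcal L_1=\{s_1,\dots,s_{n_1}\}$ and back-end servers $\mathcal L_2=\{s_{n_1+1},\dots,s_{n_1+n_2}\}$. Processes may crash, and they communicate by asynchronous point-to-point messages. Let $\mathcal C$ be an exact-repair regenerating code with parameters $\{(n_1+n_2,k,d)(\alpha,\beta)\}$ over a finite field (for instance a minimum bandwidth regenerating code), in which the helper data sent by a server depends only on its own content and on the index of the symbol under repair. Object values $v\in\mathcal V$ are encoded by $\mathcal C$, with coded elements $c_1,\dots,c_{n_1+n_2}$, and $v_0\in\mathcal V$ is the initial value. Tags are pairs $(z,w)\in\mathbb N\times\mathcal W$, ordered lexicographically, and $t_0=(0,w_0)$, with an arbitrary $w_0\in\mathcal W$, is the initial tag. Answers to clients are matched with the operation they answer. **The LDS algorithm.** *Writer $w$, value $v$.* (1) Query $\mathcal L_1$ for tags, await $f_1+k$ answers, take the maximum $t$. (2) Send $(t_w,v)$ with $t_w=(t.z+1,w)$ to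 $\mathcal L_1$, await $f_1+k$ acknowledgements, and respond. *Reader $r$.* (1) Query $\mathcal L_1$ for committed tags, await $f_1+k$ answers, take the maximum $t_{req}$. (2) Send $t_{req}$ to $\mathcal L_1$; await answers from $f_1+k$ servers among which there is a (tag, value) pair with tag $\ge t_{req}$, or there are (tag, coded-element) pairs from $k$ servers for a common tag $\ge t_{req}$, whose value is then decoded; select the available pair $(t_r,v_r)$ of highest tag. (3) Send $t_r$ to $\mathcal L_1$, await $f_1+k$ acknowledgements, and return $v_r$. *Server $s_j\in\mathcal L_1$* keeps a list $L$ of (tag, value or $\bot$) pairs, initially $\{(t_0,\bot)\}$; a committed tag $t_c$, initially $t_0$; a set $\Gamma$ of registered reads with their requested tags, initially empty; counters, initially $0$; and received helper data. "Serving" a pair $(t,v)$ means sending it to all registered reads with requested tag $\le t$ and unregistering them. "Garbage collection" replaces by $\bot$ the values in $L$ of all tags below $t_c$. "Write-to-L2" of $(t,v)$ means sending $(t,c_{n_1+i}(v))$ to every $s_{n_1+i}\in\mathcal L_2$. - A tag query is answered with the maximal tag in $L$; a committed-tag query is answered with $t_c$. - On $(t,v)$ from a writer: broadcast COMMIT-TAG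 $t$ to $\mathcal L_1$; if $t>t_c$, add $(t,v)$ to $L$, otherwise acknowledge to the writer of $t$. - On COMMIT-TAG $t$: increment the commit counter of $t$; if $t$ occurs in $L$ and the counter is at least $f_1+k$, acknowledge to the writer of $t$ and, if moreover $t>t_c$, set $t_c=t$, serve $(t,v)$, garbage collect and perform write-to-L2 of $(t,v)$. After $n_2-f_2$ acknowledgements from $\mathcal L_2$ for $t$, replace the value of $t$ in $L$ by $\bot$. - On a data query with $t_{req}$: if $L$ holds a value for $t_{req}$, send that pair; otherwise, if $t_c>t_{req}$ and $L$ holds a value for $t_c$, send that pair; otherwise register the read in $\Gamma$ and request helper data from all of $\mathcal L_2$. When $n_2-f_2$ helper elements have arrived for the read, regenerate $c_j$ for the highest tag carried by at least $d$ of them; if the read is still registered, send it this (tag, coded-element) pair if the tag is $\ge t_{req}$, and $(\bot,\bot)$ if it is not or if nothing can be regenerated. - On a tag $t$ written back by a reader: unregister that read; if $t>t_c$, set $t_c=t$; then, if $L$ holds a value $v$ for $t$, serve $(t,v)$ and perform write-to-L2 of $(t,v)$; if it does not, add $(t,\bot)$ to $L$ and serve the pair of the highest tag below $t$ that has a value in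 $L$, if any; in both cases garbage collect. Finally (also when $t\le t_c$) acknowledge to the reader. *Server $s_{n_1+i}\in\mathcal L_2$* stores one pair (tag, coded element), initially $(t_0,c_{n_1+i}(v_0))$. It replaces the pair by a received one with a higher tag, acknowledges every received pair, and answers helper requests from $s_j$ with its tag and its helper data for repairing $c_j$. Every such block of code is one atomic action. An execution is a finite or infinite alternating sequence of global states and actions (invocations, responses, local steps of clients, receipts of messages, crashes) starting in the initial state. It is well-formed if every client invokes an operation only after its previous operation, if any, has responded. **Theorem (Atomicity).** Every well-formed execution of the LDS algorithm is atomic (linearizable): there are a set $\Phi$ consisting of all complete operations and some of the incomplete ones, return values for the incomplete reads in $\Phi$, and pairwise distinct serialization points for the operations in $\Phi$, each lying after the invocation and, for a complete operation, before the response of its operation, such that every read in $\Phi$ returns the value written by the last write in $\Phi$ whose serialization point precedes that of the read, or $v_0$ if there is no such write. -/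

import Mathlib

namespace LDS

/-- An exact-repair regenerating code with parameters `{(n, k, d)(α, β)}` and file size `B`, over
the alphabet `F`. A file is encoded into `n` symbols of `F ^ α`; any `k` of them determine the file;
the symbol with index `j` is recovered exactly from helper data in `F ^ β` of any `d` other indices.
The helper data computed by `i` depends on its own content and on the index `j` under repair only,
not on the other helpers. (The minimum bandwidth point is `α = d * β` and
`B = ∑ i < k, (d - i) * β`; these equations are not required.) -/
structure RegeneratingCode (F : Type*) (n k d α β B : ℕ) where
  encode : (Fin B → F) → Fin n → (Fin α → F)
  /-- `helper i j c`: data sent by `i`, which stores `c`, for the repair of index `j` -/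
  helper : Fin n → Fin n → (Fin α → F) → (Fin β → F)
  /-- `repair j D h`: the symbol `j` computed from the helper data `h i`, `i ∈ D` -/
  repair : Fin n → Finset (Fin n) → (Fin n → (Fin β → F)) → (Fin α → F)
  /-- `decode S c`: the file computed from the symbols `c i`, `i ∈ S` -/
  decode : Finset (Fin n) → (Fin n → (Fin α → F)) → (Fin B → F)
  decode_eq : ∀ (x : Fin B → F) (S : Finset (Fin n)) (c : Fin n → (Fin α → F)),
    S.card = k → (∀ i ∈ S, c i = encode x i) → decode S c = x
  repair_eq : ∀ (x : Fin B → F) (j : Fin n) (D : Finset (Fin n)) (h : Fin n → (Fin β → F)),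
    D.card = d → j ∉ D → (∀ i ∈ D, h i = helper i j (encode x i)) → repair j D h = encode x j

/-- The static parameters of the system: layer sizes, numbers of tolerated crashes, the code `𝒞` of
length `n₁ + n₂`, the presentation of object values as files, and the initial value of the object.
The edge server `j : Fin n₁` has code index `Fin.castAdd n₂ j`, the back-end server `i : Fin n₂` has
code index `Fin.natAdd n₁ i`. -/
structure Config (V F : Type*) where
  (n₁ n₂ f₁ f₂ k d α β B : ℕ)
  n₁_eq : n₁ = 2 * f₁ + k
  n₂_eq : n₂ = 2 * f₂ + d
  f₁_lt : 2 * f₁ < n₁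
  f₂_lt : 3 * f₂ < n₂
  k_le_d : k ≤ d
  code : RegeneratingCode F (n₁ + n₂) k d α β B
  file : V ↪ (Fin B → F)
  v₀ : V

/-- Tags `(z, w)`, ordered lexicographically. -/
abbrev Tag (W : Type*) := ℕ ×ₗ W

/-- The integer part `t.z` of a tag. -/
def tagZ {W : Type*} (t : Tag W) : ℕ := (ofLex t).1

/-- The writer `t.w` of a tag. -/
def tagW {W : Type*} (t : Tag W) : W := (ofLex t).2

/-- The initial tag `t₀`; tags created by writers have positive integer part. -/
def tag₀ {W : Type*} (w₀ : W) : Tag W := toLex (0, w₀)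

/-- The tag `(t.z + 1, w)` that writer `w` creates from `t`. -/
def newTag {W : Type*} (t : Tag W) (w : W) : Tag W := toLex (tagZ t + 1, w)

section Algorithm

variable {V F : Type*}

/-- The processes: writers, readers, servers of the edge layer `ℒ₁` and of the back-end
layer `ℒ₂`. -/
inductive Proc (W R : Type*) (C : Config V F) where
  | writer (w : W)
  | reader (r : R)
  | edge (j : Fin C.n₁)
  | back (i : Fin C.n₂)

/-- Content of an answer to a reader in its `get-data` phase: a (tag, value) pair, a
(tag, coded-element) pair, or `(⊥, ⊥)`. -/
inductive DataResp (W : Type*) (C : Config V F) where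
  | value (t : Tag W) (v : V)
  | coded (t : Tag W) (c : Fin C.α → F)
  | failed

/-- Messages. Requests of a client carry the number `q` of the client's current operation, and the
answers repeat it, so that a client can tell which request is being answered (the answer to
`PUT-DATA` carries the tag, which already identifies the write). -/
inductive Msg (W R : Type*) (C : Config V F) where
  | queryTag (q : ℕ)
  | tagResp (q : ℕ) (t : Tag W)
  | putData (t : Tag W) (v : V)
  | ackWrite (t : Tag W)
  | commitTag (t : Tag W)
  | queryCommTag (q : ℕ)
  | commTagResp (q : ℕ) (t : Tag W)
  | queryData (q : ℕ) (treq : Tag W)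
  | dataResp (q : ℕ) (x : DataResp W C)
  | putTag (q : ℕ) (t : Tag W)
  | ackRead (q : ℕ)
  | writeCodeElem (t : Tag W) (c : Fin C.α → F)
  | ackCodeElem (t : Tag W)
  | queryCodeElem (ρ : R × ℕ)
  | sendHelperElem (ρ : R × ℕ) (t : Tag W) (h : Fin C.β → F)

/-- A message in transit on the link from `src` to `dst`. -/
structure Packet (W R : Type*) (C : Config V F) where
  src : Proc W R C
  dst : Proc W R C
  msg : Msg W R C

/-- One copy of `m` for every server of `ℒ₁`. -/
def toEdges {W R : Type*} {C : Config V F} (src : Proc W R C) (m : Msg W R C) :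
    Multiset (Packet W R C) :=
  (Finset.univ : Finset (Fin C.n₁)).val.map fun j => ⟨src, .edge j, m⟩

/-- `m i` for every server `i` of `ℒ₂`. -/
def toBacks {W R : Type*} {C : Config V F} (src : Proc W R C) (m : Fin C.n₂ → Msg W R C) :
    Multiset (Packet W R C) :=
  (Finset.univ : Finset (Fin C.n₂)).val.map fun i => ⟨src, .back i, m i⟩

/-! ### Local states -/

inductive WriterPhase (W : Type*) (C : Config V F) where
  | idle
  /-- `get-tag` for writing `v`; `resps j` is the tag received from `j`, if any -/
  | getTag (v : V) (resps : Fin C.n₁ → Option (Tag W))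
  /-- `put-data` with tag `t`; `acks` are the servers that have answered -/
  | putData (t : Tag W) (acks : Finset (Fin C.n₁))

structure WriterState (W : Type*) (C : Config V F) where
  /-- number of operations invoked so far -/
  q : ℕ
  phase : WriterPhase W C

inductive ReaderPhase (W : Type*) (C : Config V F) where
  | idle
  | getCommTag (resps : Fin C.n₁ → Option (Tag W))
  /-- `get-data`; a server may answer more than once -/
  | getData (treq : Tag W) (resps : Set (Fin C.n₁ × DataResp W C))
  | putTag (t : Tag W) (v : V) (acks : Finset (Fin C.n₁))

structure ReaderState (W : Type*) (C : Config V F) where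
  /-- number of operations invoked so far -/
  q : ℕ
  phase : ReaderPhase W C

/-- State of a server of `ℒ₁`. In `L`, `none` stands for `⊥`. A read operation is identified by the
pair `ρ = (r, q)` of its reader and its number. -/
structure EdgeState (W R : Type*) (C : Config V F) where
  L : Set (Tag W × Option V)
  Γ : Finset ((R × ℕ) × Tag W)
  tc : Tag W
  commitCounter : Tag W → ℕ
  readCounter : R × ℕ → ℕ
  writeCounter : Tag W → ℕ
  K : R × ℕ → Set (Tag W × Fin C.n₂ × (Fin C.β → F))

/-- State of a server of `ℒ₂`. -/
structure BackState (W : Type*) (C : Config V F) where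
  t : Tag W
  c : Fin C.α → F

/-- The global state. `net` is the multiset of messages in transit (links may reorder), `crashed`
the set of crashed processes. -/
structure State (W R : Type*) (C : Config V F) where
  writers : W → WriterState W C
  readers : R → ReaderState W C
  edges : Fin C.n₁ → EdgeState W R C
  backs : Fin C.n₂ → BackState W C
  net : Multiset (Packet W R C)
  crashed : Set (Proc W R C)

/-- The symbol of server `i` of `ℒ₂` in the codeword of `v`. -/
def backSymbol (C : Config V F) (v : V) (i : Fin C.n₂) : Fin C.α → F :=
  C.code.encode (C.file v) (Fin.natAdd C.n₁ i)

/-- The initial state. -/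
def State.start (W R : Type*) (C : Config V F) (w₀ : W) : State W R C where
  writers _ := ⟨0, .idle⟩
  readers _ := ⟨0, .idle⟩
  edges _ :=
    { L := {(tag₀ w₀, none)}
      Γ := ∅
      tc := tag₀ w₀
      commitCounter := fun _ => 0
      readCounter := fun _ => 0
      writeCounter := fun _ => 0
      K := fun _ => ∅ }
  backs i := ⟨tag₀ w₀, backSymbol C C.v₀ i⟩
  net := 0
  crashed := ∅

/-! ### Reactions to received messages -/

/-- The list `L` after replacing the values of all tags less than `t` by `⊥`. -/
def dropBelow {W : Type*} [LinearOrder W] (L : Set (Tag W × Option V)) (t : Tag W) :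
    Set (Tag W × Option V) :=
  {p | p ∈ L ∧ ¬ p.1 < t} ∪ {p | p.1 < t ∧ p.2 = none ∧ ∃ x, (p.1, x) ∈ L}

/-- The list `L` after replacing the value of the tag `t` by `⊥`. -/
def dropAt {W : Type*} (L : Set (Tag W × Option V)) (t : Tag W) : Set (Tag W × Option V) :=
  {p | p ∈ L ∧ p.1 ≠ t} ∪ {(t, none)}

/-- Messages that serve `(t, v)` to all registered reads with requested tag at most `t`. -/
def serve {W R : Type*} [LinearOrder W] {C : Config V F} (j : Fin C.n₁)
    (Γ : Finset ((R × ℕ) × Tag W)) (t : Tag W) (v : V) : Multiset (Packet W R C) :=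
  (Γ.filter fun γ => γ.2 ≤ t).val.map fun γ =>
    ⟨.edge j, .reader γ.1.1, .dataResp γ.1.2 (.value t v)⟩

/-- The reads that remain registered after `serve`. -/
def unserved {W R : Type*} [LinearOrder W] (Γ : Finset ((R × ℕ) × Tag W)) (t : Tag W) :
    Finset ((R × ℕ) × Tag W) :=
  Γ.filter fun γ => ¬ γ.2 ≤ t

/-- Messages of `write-to-L2 (t, v)`. -/
def writeToL2 {W R : Type*} {C : Config V F} (j : Fin C.n₁) (t : Tag W) (v : V) :
    Multiset (Packet W R C) :=
  toBacks (.edge j) fun i => .writeCodeElem t (backSymbol C v i)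

/-- The tag `t` can be regenerated from `K`: there is helper data for it from at least `d`
servers. -/
def Regenerable {W : Type*} (C : Config V F) (K : Set (Tag W × Fin C.n₂ × (Fin C.β → F)))
    (t : Tag W) : Prop :=
  ∃ D : Finset (Fin C.n₂), D.card = C.d ∧ ∀ i ∈ D, ∃ h, (t, i, h) ∈ K

/-- `res` is a result at server `j` of regenerating the highest possible tag using `K`. -/
def Regenerates {W : Type*} [LinearOrder W] (C : Config V F) (j : Fin C.n₁)
    (K : Set (Tag W × Fin C.n₂ × (Fin C.β → F))) (res : Option (Tag W × (Fin C.α → F))) : Prop :=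
  match res with
  | none => ∀ t, ¬ Regenerable C K t
  | some (t, c) => IsGreatest {t | Regenerable C K t} t ∧
      ∃ (D : Finset (Fin C.n₂)) (h : Fin (C.n₁ + C.n₂) → (Fin C.β → F)),
        D.card = C.d ∧ (∀ i ∈ D, (t, i, h (Fin.natAdd C.n₁ i)) ∈ K) ∧
        c = C.code.repair (Fin.castAdd C.n₂ j) (D.map (Fin.natAddEmb C.n₁)) h

/-- What is sent to a registered read with requested tag `treq` after the regeneration. -/
def regenAnswer {W : Type*} [LinearOrder W] {C : Config V F} (treq : Tag W) :
    Option (Tag W × (Fin C.α → F)) → DataResp W C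
  | some (t, c) => if treq ≤ t then .coded t c else .failed
  | none => .failed

/-- `EdgeRecv j σ src m σ' out`: on receiving `m` from `src`, the server `j` of `ℒ₁` in state `σ`
can go to state `σ'` and send the messages `out`. -/
inductive EdgeRecv {W R : Type*} [LinearOrder W] [DecidableEq R] {C : Config V F} (j : Fin C.n₁) :
    EdgeState W R C → Proc W R C → Msg W R C → EdgeState W R C → Multiset (Packet W R C) → Prop
  | getTagResp (σ : EdgeState W R C) (w : W) (q : ℕ) (t : Tag W)
      (ht : IsGreatest {t | ∃ x, (t, x) ∈ σ.L} t) :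
      EdgeRecv j σ (.writer w) (.queryTag q) σ {⟨.edge j, .writer w, .tagResp q t⟩}
  /- `put-data-resp` -/
  | putDataNew (σ : EdgeState W R C) (w : W) (t : Tag W) (v : V) (ht : σ.tc < t) :
      EdgeRecv j σ (.writer w) (.putData t v)
        { σ with L := σ.L ∪ {(t, some v)} }
        (toEdges (.edge j) (.commitTag t))
  | putDataOld (σ : EdgeState W R C) (w : W) (t : Tag W) (v : V) (ht : ¬ σ.tc < t) :
      EdgeRecv j σ (.writer w) (.putData t v) σ
        (toEdges (.edge j) (.commitTag t) + {⟨.edge j, .writer (tagW t), .ackWrite t⟩})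
  /- `broadcast-resp`: the condition of the outer test fails -/
  | commitWait (σ : EdgeState W R C) (src : Proc W R C) (t : Tag W)
      (h : ¬ ((∃ x, (t, x) ∈ σ.L) ∧ C.f₁ + C.k ≤ σ.commitCounter t + 1)) :
      EdgeRecv j σ src (.commitTag t)
        { σ with commitCounter := Function.update σ.commitCounter t (σ.commitCounter t + 1) } 0
  /- `broadcast-resp`: the outer test succeeds, and the tag is not above the committed tag -/
  | commitOld (σ : EdgeState W R C) (src : Proc W R C) (t : Tag W)
      (h : (∃ x, (t, x) ∈ σ.L) ∧ C.f₁ + C.k ≤ σ.commitCounter t + 1) (ht : ¬ σ.tc < t) :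
      EdgeRecv j σ src (.commitTag t)
        { σ with commitCounter := Function.update σ.commitCounter t (σ.commitCounter t + 1) }
        {⟨.edge j, .writer (tagW t), .ackWrite t⟩}
  /- `broadcast-resp`: the outer test succeeds, and the tag gets committed -/
  | commitNew (σ : EdgeState W R C) (src : Proc W R C) (t : Tag W) (v : V)
      (hv : (t, some v) ∈ σ.L) (h : C.f₁ + C.k ≤ σ.commitCounter t + 1) (ht : σ.tc < t) :
      EdgeRecv j σ src (.commitTag t)
        { σ with
          commitCounter := Function.update σ.commitCounter t (σ.commitCounter t + 1)
          tc := t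
          Γ := unserved σ.Γ t
          L := dropBelow σ.L t }
        ({⟨.edge j, .writer (tagW t), .ackWrite t⟩} + serve j σ.Γ t v + writeToL2 j t v)
  /- `write-to-L2-complete` -/
  | ackCodeWait (σ : EdgeState W R C) (i : Fin C.n₂) (t : Tag W)
      (h : σ.writeCounter t + 1 ≠ C.n₂ - C.f₂) :
      EdgeRecv j σ (.back i) (.ackCodeElem t)
        { σ with writeCounter := Function.update σ.writeCounter t (σ.writeCounter t + 1) } 0
  | ackCodeDone (σ : EdgeState W R C) (i : Fin C.n₂) (t : Tag W)
      (h : σ.writeCounter t + 1 = C.n₂ - C.f₂) :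
      EdgeRecv j σ (.back i) (.ackCodeElem t)
        { σ with
          writeCounter := Function.update σ.writeCounter t (σ.writeCounter t + 1)
          L := dropAt σ.L t } 0
  | getCommTagResp (σ : EdgeState W R C) (r : R) (q : ℕ) :
      EdgeRecv j σ (.reader r) (.queryCommTag q) σ
        {⟨.edge j, .reader r, .commTagResp q σ.tc⟩}
  /- `get-data-resp` -/
  | getDataReq (σ : EdgeState W R C) (r : R) (q : ℕ) (treq : Tag W) (v : V)
      (hv : (treq, some v) ∈ σ.L) :
      EdgeRecv j σ (.reader r) (.queryData q treq) σ
        {⟨.edge j, .reader r, .dataResp q (.value treq v)⟩}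
  | getDataComm (σ : EdgeState W R C) (r : R) (q : ℕ) (treq : Tag W) (v : V)
      (h : ∀ u, (treq, some u) ∉ σ.L) (ht : treq < σ.tc) (hv : (σ.tc, some v) ∈ σ.L) :
      EdgeRecv j σ (.reader r) (.queryData q treq) σ
        {⟨.edge j, .reader r, .dataResp q (.value σ.tc v)⟩}
  | getDataRegenerate (σ : EdgeState W R C) (r : R) (q : ℕ) (treq : Tag W)
      (h : ∀ u, (treq, some u) ∉ σ.L) (h' : ¬ (treq < σ.tc ∧ ∃ v, (σ.tc, some v) ∈ σ.L)) :
      EdgeRecv j σ (.reader r) (.queryData q treq)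
        { σ with Γ := insert ((r, q), treq) σ.Γ }
        (toBacks (.edge j) fun _ => .queryCodeElem (r, q))
  /- `regenerate-from-L2-complete` -/
  | helperWait (σ : EdgeState W R C) (i : Fin C.n₂) (ρ : R × ℕ) (t : Tag W) (h : Fin C.β → F)
      (hn : σ.readCounter ρ + 1 ≠ C.n₂ - C.f₂) :
      EdgeRecv j σ (.back i) (.sendHelperElem ρ t h)
        { σ with
          readCounter := Function.update σ.readCounter ρ (σ.readCounter ρ + 1)
          K := Function.update σ.K ρ (σ.K ρ ∪ {(t, i, h)}) } 0
  | helperDone (σ : EdgeState W R C) (i : Fin C.n₂) (ρ : R × ℕ) (t : Tag W) (h : Fin C.β → F)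
      (res : Option (Tag W × (Fin C.α → F)))
      (hn : σ.readCounter ρ + 1 = C.n₂ - C.f₂)
      (hres : Regenerates C j (σ.K ρ ∪ {(t, i, h)}) res) :
      EdgeRecv j σ (.back i) (.sendHelperElem ρ t h)
        { σ with
          readCounter := Function.update σ.readCounter ρ (σ.readCounter ρ + 1)
          K := Function.update σ.K ρ ∅ }
        ((σ.Γ.filter fun γ => γ.1 = ρ).val.map fun γ =>
          ⟨.edge j, .reader ρ.1, .dataResp ρ.2 (regenAnswer γ.2 res)⟩)
  /- `put-tag-resp` -/
  | putTagOld (σ : EdgeState W R C) (r : R) (q : ℕ) (t : Tag W) (ht : ¬ σ.tc < t) :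
      EdgeRecv j σ (.reader r) (.putTag q t)
        { σ with Γ := σ.Γ.filter fun γ => γ.1 ≠ (r, q) }
        {⟨.edge j, .reader r, .ackRead q⟩}
  | putTagValue (σ : EdgeState W R C) (r : R) (q : ℕ) (t : Tag W) (v : V) (ht : σ.tc < t)
      (hv : (t, some v) ∈ σ.L) :
      EdgeRecv j σ (.reader r) (.putTag q t)
        { σ with
          tc := t
          Γ := unserved (σ.Γ.filter fun γ => γ.1 ≠ (r, q)) t
          L := dropBelow σ.L t }
        (serve j (σ.Γ.filter fun γ => γ.1 ≠ (r, q)) t v + writeToL2 j t v +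
          {⟨.edge j, .reader r, .ackRead q⟩})
  /- no value for `t` in the list; `t'` is the highest tag below `t` that has a value `v'` -/
  | putTagOlder (σ : EdgeState W R C) (r : R) (q : ℕ) (t t' : Tag W) (v' : V) (ht : σ.tc < t)
      (hv : ∀ v, (t, some v) ∉ σ.L) (ht' : IsGreatest {u | u < t ∧ ∃ v, (u, some v) ∈ σ.L} t')
      (hv' : (t', some v') ∈ σ.L) :
      EdgeRecv j σ (.reader r) (.putTag q t)
        { σ with
          tc := t
          Γ := unserved (σ.Γ.filter fun γ => γ.1 ≠ (r, q)) t'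
          L := dropBelow (σ.L ∪ {(t, none)}) t }
        (serve j (σ.Γ.filter fun γ => γ.1 ≠ (r, q)) t' v' + {⟨.edge j, .reader r, .ackRead q⟩})
  /- no value for `t` in the list, and none for any smaller tag -/
  | putTagNone (σ : EdgeState W R C) (r : R) (q : ℕ) (t : Tag W) (ht : σ.tc < t)
      (hv : ∀ v, (t, some v) ∉ σ.L) (hn : ∀ u < t, ∀ v, (u, some v) ∉ σ.L) :
      EdgeRecv j σ (.reader r) (.putTag q t)
        { σ with
          tc := t
          Γ := σ.Γ.filter fun γ => γ.1 ≠ (r, q)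
          L := dropBelow (σ.L ∪ {(t, none)}) t }
        {⟨.edge j, .reader r, .ackRead q⟩}

/-- Reaction of the server `i` of `ℒ₂` to a message from the server `j` of `ℒ₁`. -/
inductive BackRecv {W R : Type*} [LinearOrder W] {C : Config V F} (i : Fin C.n₂) (j : Fin C.n₁) :
    BackState W C → Msg W R C → BackState W C → Multiset (Packet W R C) → Prop
  | writeNew (σ : BackState W C) (t : Tag W) (c : Fin C.α → F) (ht : σ.t < t) :
      BackRecv i j σ (.writeCodeElem t c) ⟨t, c⟩ {⟨.back i, .edge j, .ackCodeElem t⟩}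
  | writeOld (σ : BackState W C) (t : Tag W) (c : Fin C.α → F) (ht : ¬ σ.t < t) :
      BackRecv i j σ (.writeCodeElem t c) σ {⟨.back i, .edge j, .ackCodeElem t⟩}
  | help (σ : BackState W C) (ρ : R × ℕ) :
      BackRecv i j σ (.queryCodeElem ρ) σ
        {⟨.back i, .edge j, .sendHelperElem ρ σ.t
          (C.code.helper (Fin.natAdd C.n₁ i) (Fin.castAdd C.n₂ j) σ.c)⟩}

/-- A writer records an answer of the server `j` to its current request and ignores everything
else. -/
def WriterState.recv {W R : Type*} [LinearOrder W] {C : Config V F} (σ : WriterState W C)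
    (j : Fin C.n₁) (m : Msg W R C) : WriterState W C :=
  match σ.phase, m with
  | .getTag v resps, .tagResp q t =>
      if q = σ.q then ⟨σ.q, .getTag v (Function.update resps j (some t))⟩ else σ
  | .putData t acks, .ackWrite t' =>
      if t' = t then ⟨σ.q, .putData t (insert j acks)⟩ else σ
  | _, _ => σ

/-- A reader records an answer of the server `j` to its current request and ignores everything
else. -/
def ReaderState.recv {W R : Type*} {C : Config V F} (σ : ReaderState W C)
    (j : Fin C.n₁) (m : Msg W R C) : ReaderState W C :=
  match σ.phase, m with
  | .getCommTag resps, .commTagResp q t =>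
      if q = σ.q then ⟨σ.q, .getCommTag (Function.update resps j (some t))⟩ else σ
  | .getData treq resps, .dataResp q x =>
      if q = σ.q then ⟨σ.q, .getData treq (resps ∪ {(j, x)})⟩ else σ
  | .putTag t v acks, .ackRead q =>
      if q = σ.q then ⟨σ.q, .putTag t v (insert j acks)⟩ else σ
  | _, _ => σ

/-- At least `f₁ + k` servers of `ℒ₁` have answered with a tag, and `t` is the largest of the tags
received. -/
def QuorumMax {W : Type*} [LinearOrder W] (C : Config V F) (resps : Fin C.n₁ → Option (Tag W))
    (t : Tag W) : Prop :=
  C.f₁ + C.k ≤ {j | resps j ≠ none}.ncard ∧ IsGreatest {u | ∃ j, resps j = some u} t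

/-- The pair `(t, v)` is available to a reader in the `get-data` phase: `t` is at least the requested
tag, and either the pair was received, or `v` is decoded from `k` coded elements received for the
tag `t`. -/
def Available {W : Type*} [LinearOrder W] {C : Config V F} (treq : Tag W)
    (resps : Set (Fin C.n₁ × DataResp W C)) (t : Tag W) (v : V) : Prop :=
  treq ≤ t ∧
    ((∃ j, (j, DataResp.value t v) ∈ resps) ∨
      ∃ (S : Finset (Fin C.n₁)) (c : Fin (C.n₁ + C.n₂) → (Fin C.α → F)),
        S.card = C.k ∧ (∀ j ∈ S, (j, DataResp.coded t (c (Fin.castAdd C.n₂ j))) ∈ resps) ∧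
        C.code.decode (S.map (Fin.castAddEmb C.n₂)) c = C.file v)

/-! ### Actions, steps, executions -/

inductive Action (W R : Type*) (C : Config V F) where
  | invokeWrite (w : W) (v : V)
  | respondWrite (w : W)
  | invokeRead (r : R)
  | respondRead (r : R) (v : V)
  | startPutData (w : W)
  | startGetData (r : R)
  | startPutTag (r : R)
  | recv (p : Packet W R C)
  | crash (p : Proc W R C)

/-- The transition relation. An action is a block of code executed by one process; a crashed process
takes no further steps. An invocation is possible in every state of a client that has not crashed:
that a client does not start an operation before the previous one is complete is a property of
executions, stated in `Execution.WellFormed`. -/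
inductive Step {W R : Type*} [LinearOrder W] [DecidableEq R] {C : Config V F} :
    State W R C → Action W R C → State W R C → Prop
  | invokeWrite (s : State W R C) (w : W) (v : V) (hc : .writer w ∉ s.crashed) :
      Step s (.invokeWrite w v)
        { s with
          writers := Function.update s.writers w ⟨(s.writers w).q + 1, .getTag v fun _ => none⟩
          net := s.net + toEdges (.writer w) (.queryTag ((s.writers w).q + 1)) }
  | startPutData (s : State W R C) (w : W) (q : ℕ) (v : V) (resps : Fin C.n₁ → Option (Tag W))
      (t : Tag W) (hc : .writer w ∉ s.crashed) (hs : s.writers w = ⟨q, .getTag v resps⟩)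
      (ht : QuorumMax C resps t) :
      Step s (.startPutData w)
        { s with
          writers := Function.update s.writers w ⟨q, .putData (newTag t w) ∅⟩
          net := s.net + toEdges (.writer w) (.putData (newTag t w) v) }
  | respondWrite (s : State W R C) (w : W) (q : ℕ) (t : Tag W) (acks : Finset (Fin C.n₁))
      (hc : .writer w ∉ s.crashed) (hs : s.writers w = ⟨q, .putData t acks⟩)
      (ha : C.f₁ + C.k ≤ acks.card) :
      Step s (.respondWrite w) { s with writers := Function.update s.writers w ⟨q, .idle⟩ }
  | invokeRead (s : State W R C) (r : R) (hc : .reader r ∉ s.crashed) :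
      Step s (.invokeRead r)
        { s with
          readers := Function.update s.readers r ⟨(s.readers r).q + 1, .getCommTag fun _ => none⟩
          net := s.net + toEdges (.reader r) (.queryCommTag ((s.readers r).q + 1)) }
  | startGetData (s : State W R C) (r : R) (q : ℕ) (resps : Fin C.n₁ → Option (Tag W))
      (t : Tag W) (hc : .reader r ∉ s.crashed) (hs : s.readers r = ⟨q, .getCommTag resps⟩)
      (ht : QuorumMax C resps t) :
      Step s (.startGetData r)
        { s with
          readers := Function.update s.readers r ⟨q, .getData t ∅⟩
          net := s.net + toEdges (.reader r) (.queryData q t) }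
  | startPutTag (s : State W R C) (r : R) (q : ℕ) (treq : Tag W)
      (resps : Set (Fin C.n₁ × DataResp W C)) (t : Tag W) (v : V)
      (hc : .reader r ∉ s.crashed) (hs : s.readers r = ⟨q, .getData treq resps⟩)
      (hq : C.f₁ + C.k ≤ {j | ∃ x, (j, x) ∈ resps}.ncard)
      (ha : Available treq resps t v) (hm : ∀ t' v', Available treq resps t' v' → t' ≤ t) :
      Step s (.startPutTag r)
        { s with
          readers := Function.update s.readers r ⟨q, .putTag t v ∅⟩
          net := s.net + toEdges (.reader r) (.putTag q t) }
  | respondRead (s : State W R C) (r : R) (q : ℕ) (t : Tag W) (v : V) (acks : Finset (Fin C.n₁))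
      (hc : .reader r ∉ s.crashed) (hs : s.readers r = ⟨q, .putTag t v acks⟩)
      (ha : C.f₁ + C.k ≤ acks.card) :
      Step s (.respondRead r v) { s with readers := Function.update s.readers r ⟨q, .idle⟩ }
  | recvWriter (s : State W R C) (j : Fin C.n₁) (w : W) (m : Msg W R C)
      (net : Multiset (Packet W R C)) (hc : .writer w ∉ s.crashed)
      (hn : s.net = ⟨.edge j, .writer w, m⟩ ::ₘ net) :
      Step s (.recv ⟨.edge j, .writer w, m⟩)
        { s with writers := Function.update s.writers w ((s.writers w).recv j m), net := net }
  | recvReader (s : State W R C) (j : Fin C.n₁) (r : R) (m : Msg W R C)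
      (net : Multiset (Packet W R C)) (hc : .reader r ∉ s.crashed)
      (hn : s.net = ⟨.edge j, .reader r, m⟩ ::ₘ net) :
      Step s (.recv ⟨.edge j, .reader r, m⟩)
        { s with readers := Function.update s.readers r ((s.readers r).recv j m), net := net }
  | recvEdge (s : State W R C) (src : Proc W R C) (j : Fin C.n₁) (m : Msg W R C)
      (net out : Multiset (Packet W R C)) (σ' : EdgeState W R C) (hc : .edge j ∉ s.crashed)
      (hn : s.net = ⟨src, .edge j, m⟩ ::ₘ net) (hr : EdgeRecv j (s.edges j) src m σ' out) :
      Step s (.recv ⟨src, .edge j, m⟩)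
        { s with edges := Function.update s.edges j σ', net := net + out }
  | recvBack (s : State W R C) (j : Fin C.n₁) (i : Fin C.n₂) (m : Msg W R C)
      (net out : Multiset (Packet W R C)) (σ' : BackState W C) (hc : .back i ∉ s.crashed)
      (hn : s.net = ⟨.edge j, .back i, m⟩ ::ₘ net) (hr : BackRecv i j (s.backs i) m σ' out) :
      Step s (.recv ⟨.edge j, .back i, m⟩)
        { s with backs := Function.update s.backs i σ', net := net + out }
  | crash (s : State W R C) (p : Proc W R C) :
      Step s (.crash p) { s with crashed := s.crashed ∪ {p} }

/-- A finite or infinite execution: the states `state i` for `i ≤ len` and the actions `act i` from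
`state i` to `state (i + 1)` for `i < len`. No fairness is required, and any number of processes may
crash. -/
structure Execution (W R : Type*) [LinearOrder W] [DecidableEq R] (C : Config V F) (w₀ : W) where
  len : ℕ∞
  state : ℕ → State W R C
  act : ℕ → Action W R C
  state_zero : state 0 = State.start W R C w₀
  step : ∀ i : ℕ, (i : ℕ∞) < len → Step (state i) (act i) (state (i + 1))

/-- The action is an invocation at the given client. -/
def Action.Invokes {W R : Type*} {C : Config V F} (a : Action W R C) : W ⊕ R → Prop
  | .inl w => ∃ v, a = .invokeWrite w v
  | .inr r => a = .invokeRead r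

/-- The action is a response at the given client. -/
def Action.Responds {W R : Type*} {C : Config V F} (a : Action W R C) : W ⊕ R → Prop
  | .inl w => a = .respondWrite w
  | .inr r => ∃ v, a = .respondRead r v

namespace Execution

variable {W R : Type*} [LinearOrder W] [DecidableEq R] {C : Config V F} {w₀ : W}

/-- Every client invokes an operation only after completion of its previous operation, if any. -/
def WellFormed (e : Execution W R C w₀) : Prop :=
  ∀ (c : W ⊕ R) (i i' : ℕ), i < i' → (i' : ℕ∞) < e.len →
    (e.act i).Invokes c → (e.act i').Invokes c → ∃ j, i < j ∧ j < i' ∧ (e.act j).Responds c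

/-- Operations are named by the position of their invocation: `i` is a write of `v`. -/
def IsWrite (e : Execution W R C w₀) (i : ℕ) (v : V) : Prop :=
  (i : ℕ∞) < e.len ∧ ∃ w, e.act i = .invokeWrite w v

/-- `i` is a read. -/
def IsRead (e : Execution W R C w₀) (i : ℕ) : Prop :=
  (i : ℕ∞) < e.len ∧ ∃ r, e.act i = .invokeRead r

/-- The operation `i` is complete, with its response at position `j`. -/
def ResponseAt (e : Execution W R C w₀) (i j : ℕ) : Prop :=
  i < j ∧ (j : ℕ∞) < e.len ∧ ∃ c, (e.act i).Invokes c ∧ (e.act j).Responds c ∧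
    ∀ m, i < m → m < j → ¬ (e.act m).Responds c

/-- Atomicity (linearizability) of an execution: there are a set `Φ` of operations that contains all
complete ones (together with some of the incomplete ones), pairwise distinct serialization points
`pt i` for `i ∈ Φ`, each after the invocation and, for a complete operation, before the response of
`i`, and return values `ret i` of the reads in `Φ`, which are the actual ones for complete reads,
such that every read in `Φ` returns the value of the last write in `Φ` before it in the order of the
serialization points, or the initial value of the object if there is no such write. -/
def Atomic (e : Execution W R C w₀) : Prop :=
  ∃ (Φ : Set ℕ) (pt : ℕ → ℝ) (ret : ℕ → V),
    (∀ i ∈ Φ, e.IsRead i ∨ ∃ v, e.IsWrite i v) ∧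
    (∀ i j, e.ResponseAt i j → i ∈ Φ) ∧
    Set.InjOn pt Φ ∧
    (∀ i ∈ Φ, (i : ℝ) < pt i) ∧
    (∀ i j, e.ResponseAt i j → pt i < (j : ℝ)) ∧
    (∀ i j r v, e.ResponseAt i j → e.act j = .respondRead r v → ret i = v) ∧
    ∀ i ∈ Φ, e.IsRead i →
      (∃ m ∈ Φ, e.IsWrite m (ret i) ∧ pt m < pt i ∧
        ∀ m' ∈ Φ, ∀ v', e.IsWrite m' v' → pt m' < pt i → pt m' ≤ pt m) ∨
      ((∀ m ∈ Φ, ∀ v, e.IsWrite m v → ¬ pt m < pt i) ∧ ret i = C.v₀)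

end Execution

end Algorithm

end LDS

namespace LDS

variable {W R V F : Type*}

/-! Operations are linearized in the order of their tags. Three facts make this work.

Real-time order: the committed tag of an edge server never decreases, and an operation that
completes with tag `t` has acknowledgements from `f₁ + k` edge servers, each with committed tag at
least `t`. Since `n₁ = 2 * f₁ + k` and `k > 0`, any two sets of `f₁ + k` edge servers meet, so the
query phase of every operation invoked later sees a tag at least `t`. A later read then selects a
tag `≥ t`, and a later write creates a tag `> t` (`Committed.le_of_reads`, `Committed.lt_of_writes`,
resting on the invariants `State.ReadAfter` and `State.WriteAfter`). Operation numbers in the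
messages exclude stale answers (`State.Control`).

Tags name writes: writes of different writers differ in the second component, and successive writes
of one writer have increasing tags by the first fact (`WellFormed.writes_inj`). So a tag has at most
one value.

Tags carry their values: every list entry, stored symbol, helper element and answer with tag `t`
derives from the value of `t`. Repair from `d` helpers and decoding from `k` symbols are applied to
data of one common tag, so they are exact, and a read that selects `t` returns the value of `t`
(`State.Sound`, `WellFormed.sound`). Only safety is at stake: whether values survive garbage
collection, or whether quorums of back-end servers intersect, plays no role.

Finally, the complete operations, together with the writes whose tag a complete read returned, are
ordered by tag, the write of a tag before its reads, and reads of one tag by invocation. All these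
tags are committed by a quorum at some time, so initial segments are finite, and
`exists_serialization` turns the order into real points inside the operation intervals.
Well-formedness enters only where invocations and responses are matched with operation numbers. -/

theorem lt_newTag [LinearOrder W] (t : Tag W) (w : W) : t < newTag t w := by
  rw [newTag, Prod.Lex.lt_iff]
  left
  exact Nat.lt_succ_self _

theorem mem_toEdges {C : Config V F} {src : Proc W R C} {m : Msg W R C} {p : Packet W R C} :
    p ∈ toEdges src m ↔ ∃ j, p = ⟨src, .edge j, m⟩ := by
  simp [toEdges, eq_comm]

theorem mem_toBacks {C : Config V F} {src : Proc W R C} {m : Fin C.n₂ → Msg W R C}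
    {p : Packet W R C} : p ∈ toBacks src m ↔ ∃ i, p = ⟨src, .back i, m i⟩ := by
  simp [toBacks, eq_comm]

/-! ### Progress of the processes -/

/-- The writer state `σ'` is reachable from `σ`, as far as the operation number, the tag of the
current write and its completion are concerned. -/
def WriterState.Progress {C : Config V F} (σ σ' : WriterState W C) : Prop :=
  σ.q < σ'.q ∨ σ.q = σ'.q ∧ (σ.phase = .idle → σ'.phase = .idle) ∧
    ∀ t acks, σ.phase = .putData t acks → σ'.phase = .idle ∨ ∃ acks', σ'.phase = .putData t acks'

/-- The reader state `σ'` is reachable from `σ`, as far as the operation number, the result of the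
current read and its completion are concerned. -/
def ReaderState.Progress {C : Config V F} (σ σ' : ReaderState W C) : Prop :=
  σ.q < σ'.q ∨ σ.q = σ'.q ∧ (σ.phase = .idle → σ'.phase = .idle) ∧
    ∀ t v acks, σ.phase = .putTag t v acks →
      σ'.phase = .idle ∨ ∃ acks', σ'.phase = .putTag t v acks'

theorem WriterState.Progress.refl {C : Config V F} (σ : WriterState W C) : σ.Progress σ :=
  .inr ⟨rfl, id, fun _ acks h => .inr ⟨acks, h⟩⟩

theorem ReaderState.Progress.refl {C : Config V F} (σ : ReaderState W C) : σ.Progress σ :=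
  .inr ⟨rfl, id, fun _ _ acks h => .inr ⟨acks, h⟩⟩

theorem WriterState.Progress.trans {C : Config V F} {σ σ' σ'' : WriterState W C}
    (h : σ.Progress σ') (h' : σ'.Progress σ'') : σ.Progress σ'' := by
  rcases h with h | ⟨h, hi, hp⟩
  · rcases h' with h' | ⟨h', -⟩
    · exact .inl (h.trans h')
    · exact .inl (h' ▸ h)
  · rcases h' with h' | ⟨h', hi', hp'⟩
    · exact .inl (h ▸ h')
    · refine .inr ⟨h.trans h', hi' ∘ hi, fun t acks ht => ?_⟩
      rcases hp t acks ht with h1 | ⟨acks', h1⟩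
      · exact .inl (hi' h1)
      · exact hp' t acks' h1

theorem ReaderState.Progress.trans {C : Config V F} {σ σ' σ'' : ReaderState W C}
    (h : σ.Progress σ') (h' : σ'.Progress σ'') : σ.Progress σ'' := by
  rcases h with h | ⟨h, hi, hp⟩
  · rcases h' with h' | ⟨h', -⟩
    · exact .inl (h.trans h')
    · exact .inl (h' ▸ h)
  · rcases h' with h' | ⟨h', hi', hp'⟩
    · exact .inl (h ▸ h')
    · refine .inr ⟨h.trans h', hi' ∘ hi, fun t v acks ht => ?_⟩
      rcases hp t v acks ht with h1 | ⟨acks', h1⟩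
      · exact .inl (hi' h1)
      · exact hp' t v acks' h1

theorem WriterState.Progress.q_le {C : Config V F} {σ σ' : WriterState W C}
    (h : σ.Progress σ') : σ.q ≤ σ'.q := by
  rcases h with h | ⟨h, -⟩ <;> omega

theorem ReaderState.Progress.q_le {C : Config V F} {σ σ' : ReaderState W C}
    (h : σ.Progress σ') : σ.q ≤ σ'.q := by
  rcases h with h | ⟨h, -⟩ <;> omega

theorem WriterState.recv_q [LinearOrder W] {C : Config V F} (σ : WriterState W C) (j : Fin C.n₁)
    (m : Msg W R C) : (σ.recv j m).q = σ.q := by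
  unfold WriterState.recv
  split <;> first | rfl | (split_ifs <;> rfl)

theorem ReaderState.recv_q {C : Config V F} (σ : ReaderState W C) (j : Fin C.n₁)
    (m : Msg W R C) : (σ.recv j m).q = σ.q := by
  unfold ReaderState.recv
  split <;> first | rfl | (split_ifs <;> rfl)

theorem WriterState.progress_recv [LinearOrder W] {C : Config V F} (σ : WriterState W C)
    (j : Fin C.n₁) (m : Msg W R C) : σ.Progress (σ.recv j m) := by
  unfold WriterState.recv
  split
  · rename_i h
    split_ifs
    · exact .inr ⟨rfl, by simp [h], by simp [h]⟩
    · exact .refl σ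
  · rename_i h
    split_ifs
    · exact .inr ⟨rfl, by simp [h], by simp [h]⟩
    · exact .refl σ
  · exact .refl σ

theorem ReaderState.progress_recv {C : Config V F} (σ : ReaderState W C) (j : Fin C.n₁)
    (m : Msg W R C) : σ.Progress (σ.recv j m) := by
  unfold ReaderState.recv
  split
  · rename_i h
    split_ifs
    · exact .inr ⟨rfl, by simp [h], by simp [h]⟩
    · exact .refl σ
  · rename_i h
    split_ifs
    · exact .inr ⟨rfl, by simp [h], by simp [h]⟩
    · exact .refl σ
  · rename_i h
    split_ifs
    · exact .inr ⟨rfl, by simp [h], by simp [h]⟩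
    · exact .refl σ
  · exact .refl σ

/-! ### Committed tags and answers of the edge servers; monotonicity of steps -/

variable [LinearOrder W] [DecidableEq R] {C : Config V F}

/-- Every branch that assigns the committed tag is guarded by `σ.tc < t`. -/
theorem EdgeRecv.tc_le {j : Fin C.n₁} {σ σ' : EdgeState W R C} {src : Proc W R C} {m : Msg W R C}
    {out : Multiset (Packet W R C)} (h : EdgeRecv j σ src m σ' out) : σ.tc ≤ σ'.tc := by
  cases h <;> first | exact le_rfl | (apply le_of_lt; assumption)

theorem mem_dropBelow_self {L : Set (Tag W × Option V)} {t : Tag W} {x : Option V}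
    (h : (t, x) ∈ L) : (t, x) ∈ dropBelow L t :=
  .inl ⟨h, lt_irrefl _⟩

/-- The committed tag occurs in the list. -/
def EdgeState.TcMem (σ : EdgeState W R C) : Prop := ∃ x, (σ.tc, x) ∈ σ.L

/-- A newly committed tag is in the list already or is added with `⊥`, and both kinds of erasure
discard values but keep tags. This is what lets an answer to a tag query, the maximum of the list,
bound the committed tag. -/
theorem EdgeRecv.tcMem {j : Fin C.n₁} {σ σ' : EdgeState W R C} {src : Proc W R C} {m : Msg W R C}
    {out : Multiset (Packet W R C)} (h : EdgeRecv j σ src m σ' out) (hσ : σ.TcMem) :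
    σ'.TcMem := by
  obtain ⟨x, hx⟩ := hσ
  cases h with
  | putDataNew w t v ht => exact ⟨x, .inl hx⟩
  | commitNew _ t v hv h ht => exact ⟨_, mem_dropBelow_self hv⟩
  | ackCodeDone i t h =>
    by_cases h : σ.tc = t
    · exact ⟨none, .inr (by simp [h])⟩
    · exact ⟨x, .inl ⟨hx, h⟩⟩
  | putTagValue r q t v ht hv => exact ⟨_, mem_dropBelow_self hv⟩
  | putTagOlder r q t t' v' ht hv ht' hv' => exact ⟨none, mem_dropBelow_self (.inr rfl)⟩
  | putTagNone r q t ht hv hn => exact ⟨none, mem_dropBelow_self (.inr rfl)⟩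
  | _ => exact ⟨x, hx⟩

/-- What an answer to a client sent by the edge server `j` in reaction to `m` from `src` tells about
the committed tag `tc` of `j`. -/
def AnswerSound (tc : Tag W) (src : Proc W R C) (m : Msg W R C) (p : Packet W R C) : Prop :=
  (∀ q t, p.msg = .tagResp q t → m = .queryTag q ∧ p.dst = src ∧ tc ≤ t) ∧
  (∀ q t, p.msg = .commTagResp q t → m = .queryCommTag q ∧ p.dst = src ∧ tc ≤ t) ∧
  (∀ t, p.msg = .ackWrite t → t ≤ tc) ∧
  (∀ q, p.msg = .ackRead q → ∃ t, m = .putTag q t ∧ p.dst = src ∧ t ≤ tc)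

theorem EdgeRecv.src_eq {j : Fin C.n₁} {σ σ' : EdgeState W R C} {src : Proc W R C} {m : Msg W R C}
    {out : Multiset (Packet W R C)} (h : EdgeRecv j σ src m σ' out) {p : Packet W R C}
    (hp : p ∈ out) : p.src = .edge j := by
  cases h <;>
    simp only [Multiset.mem_singleton, Multiset.mem_add, mem_toEdges, mem_toBacks, serve, writeToL2,
      Multiset.mem_map, Multiset.notMem_zero] at hp <;> aesop

/-- The bound refers to the state after the reaction, since an acknowledgement may be sent by the
very block that commits the tag. Only the tag query needs `TcMem`. -/
theorem EdgeRecv.answerSound {j : Fin C.n₁} {σ σ' : EdgeState W R C} {src : Proc W R C}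
    {m : Msg W R C} {out : Multiset (Packet W R C)} (h : EdgeRecv j σ src m σ' out)
    (hσ : σ.TcMem) {p : Packet W R C} (hp : p ∈ out) : AnswerSound σ'.tc src m p := by
  obtain ⟨x, hx⟩ := hσ
  cases h <;>
    simp only [Multiset.mem_singleton, Multiset.mem_add, mem_toEdges, mem_toBacks, serve, writeToL2,
      Multiset.mem_map, Multiset.notMem_zero] at hp
  case getTagResp w q t ht =>
    subst hp
    simpa [AnswerSound] using ht.2 ⟨x, hx⟩
  all_goals
    first
    | exact hp.elim
    | (rcases hp with (hp | hp) | hp <;> first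
        | (subst hp; simp_all [AnswerSound])
        | (obtain ⟨_, rfl⟩ := hp; simp [AnswerSound])
        | (obtain ⟨_, _, rfl⟩ := hp; simp [AnswerSound]))
    | (rcases hp with hp | hp <;> first
        | (subst hp; simp_all [AnswerSound])
        | (obtain ⟨_, rfl⟩ := hp; simp [AnswerSound])
        | (obtain ⟨_, _, rfl⟩ := hp; simp [AnswerSound]))
    | (subst hp; simp_all [AnswerSound])
    | (obtain ⟨_, rfl⟩ := hp; simp [AnswerSound])
    | (obtain ⟨_, _, rfl⟩ := hp; simp [AnswerSound])

/-- Progress of all the processes. -/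
structure State.Progress (s s' : State W R C) : Prop where
  writer : ∀ w, (s.writers w).Progress (s'.writers w)
  reader : ∀ r, (s.readers r).Progress (s'.readers r)
  edge : ∀ j, (s.edges j).tc ≤ (s'.edges j).tc

theorem forall_update {ι : Type*} {α : ι → Type*} [DecidableEq ι] {P : ∀ i, α i → α i → Prop}
    {f : ∀ i, α i} {i : ι} {x : α i} (h : ∀ i y, P i y y) (hx : P i (f i) x) (i' : ι) :
    P i' (f i') (Function.update f i x i') := by
  by_cases hi : i' = i
  · subst hi
    simpa using hx
  · simpa [Function.update_of_ne hi] using h i' (f i')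

/-- Holds without well-formedness: an invocation that interrupts an operation still increases the
operation number, which dominates the comparison. -/
theorem Step.progress {s s' : State W R C} {a : Action W R C} (h : Step s a s') :
    s.Progress s' := by
  have hw := @WriterState.Progress.refl W V F C
  have hr := @ReaderState.Progress.refl W V F C
  have ht := fun j => le_refl (s.edges j).tc
  cases h with
  | invokeWrite w v hc =>
    exact ⟨forall_update (fun _ => hw) (.inl (Nat.lt_succ_self _)), fun _ => hr _, ht⟩
  | startPutData w q v resps t hc hs _ =>
    exact ⟨forall_update (fun _ => hw) (.inr ⟨by simp [hs], by simp [hs], by simp [hs]⟩),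
      fun _ => hr _, ht⟩
  | respondWrite w q t acks hc hs ha =>
    exact ⟨forall_update (fun _ => hw) (.inr ⟨by simp [hs], by simp [hs], by simp [hs]⟩),
      fun _ => hr _, ht⟩
  | invokeRead r hc =>
    exact ⟨fun _ => hw _, forall_update (fun _ => hr) (.inl (Nat.lt_succ_self _)), ht⟩
  | startGetData r q resps t hc hs _ =>
    exact ⟨fun _ => hw _,
      forall_update (fun _ => hr) (.inr ⟨by simp [hs], by simp [hs], by simp [hs]⟩), ht⟩
  | startPutTag r q treq resps t v hc hs hq ha hm =>
    exact ⟨fun _ => hw _,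
      forall_update (fun _ => hr) (.inr ⟨by simp [hs], by simp [hs], by simp [hs]⟩), ht⟩
  | respondRead r q t v acks hc hs ha =>
    exact ⟨fun _ => hw _,
      forall_update (fun _ => hr) (.inr ⟨by simp [hs], by simp [hs], by simp [hs]⟩), ht⟩
  | recvWriter j w m net hc hn =>
    exact ⟨forall_update (fun _ => hw) (WriterState.progress_recv _ _ _), fun _ => hr _, ht⟩
  | recvReader j r m net hc hn =>
    exact ⟨fun _ => hw _, forall_update (fun _ => hr) (ReaderState.progress_recv _ _ _), ht⟩
  | recvEdge src j m net out σ' hc hn h =>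
    exact ⟨fun _ => hw _, fun _ => hr _,
      forall_update (α := fun _ => EdgeState W R C) (P := fun _ x y => x.tc ≤ y.tc) (fun _ _ => le_rfl) h.tc_le⟩
  | recvBack j i m net out σ' hc hn h => exact ⟨fun _ => hw _, fun _ => hr _, ht⟩
  | crash p => exact ⟨fun _ => hw _, fun _ => hr _, ht⟩

omit [DecidableEq R] in
theorem State.Progress.trans {s s' s'' : State W R C} (h : s.Progress s') (h' : s'.Progress s'') :
    s.Progress s'' :=
  ⟨fun w => (h.writer w).trans (h'.writer w), fun r => (h.reader r).trans (h'.reader r),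
    fun j => (h.edge j).trans (h'.edge j)⟩

end LDS

/-! ### Inversion of message receipt at clients -/

namespace LDS

variable {W R V F : Type*}

/-- Invariants constrain the state after a receipt, so the receipt is read backwards: either nothing
changed, or one answer with the current operation number was recorded. The next four lemmas treat
the other phases; for `putData` the tag plays the role of the number. -/
theorem WriterState.recv_eq_getTag [LinearOrder W] {C : Config V F} {σ : WriterState W C}
    {j : Fin C.n₁} {m : Msg W R C} {q : ℕ} {v : V} {resps : Fin C.n₁ → Option (Tag W)}
    (h : σ.recv j m = ⟨q, .getTag v resps⟩) :
    σ = ⟨q, .getTag v resps⟩ ∨ ∃ resps' t, σ = ⟨q, .getTag v resps'⟩ ∧ m = .tagResp q t ∧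
      resps = Function.update resps' j (some t) := by
  obtain ⟨qσ, ph⟩ := σ
  unfold WriterState.recv at h
  split at h
  · split_ifs at h
    · simp_all
    · exact .inl h
  · split_ifs at h
    · simp at h
    · exact .inl h
  · exact .inl h

theorem WriterState.recv_eq_putData [LinearOrder W] {C : Config V F} {σ : WriterState W C}
    {j : Fin C.n₁} {m : Msg W R C} {q : ℕ} {t : Tag W} {acks : Finset (Fin C.n₁)}
    (h : σ.recv j m = ⟨q, .putData t acks⟩) :
    σ = ⟨q, .putData t acks⟩ ∨ ∃ acks', σ = ⟨q, .putData t acks'⟩ ∧ m = .ackWrite t ∧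
      acks = insert j acks' := by
  obtain ⟨qσ, ph⟩ := σ
  unfold WriterState.recv at h
  split at h
  · split_ifs at h
    · simp at h
    · exact .inl h
  · split_ifs at h
    · simp_all
    · exact .inl h
  · exact .inl h

theorem ReaderState.recv_eq_getCommTag {C : Config V F} {σ : ReaderState W C}
    {j : Fin C.n₁} {m : Msg W R C} {q : ℕ} {resps : Fin C.n₁ → Option (Tag W)}
    (h : σ.recv j m = ⟨q, .getCommTag resps⟩) :
    σ = ⟨q, .getCommTag resps⟩ ∨ ∃ resps' t, σ = ⟨q, .getCommTag resps'⟩ ∧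
      m = .commTagResp q t ∧ resps = Function.update resps' j (some t) := by
  obtain ⟨qσ, ph⟩ := σ
  unfold ReaderState.recv at h
  split at h
  · split_ifs at h
    · simp_all
    · exact .inl h
  · split_ifs at h
    · simp at h
    · exact .inl h
  · split_ifs at h
    · simp at h
    · exact .inl h
  · exact .inl h

theorem ReaderState.recv_eq_getData {C : Config V F} {σ : ReaderState W C}
    {j : Fin C.n₁} {m : Msg W R C} {q : ℕ} {t : Tag W} {resps : Set (Fin C.n₁ × DataResp W C)}
    (h : σ.recv j m = ⟨q, .getData t resps⟩) :
    σ = ⟨q, .getData t resps⟩ ∨ ∃ resps' x, σ = ⟨q, .getData t resps'⟩ ∧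
      m = .dataResp q x ∧ resps = resps' ∪ {(j, x)} := by
  obtain ⟨qσ, ph⟩ := σ
  unfold ReaderState.recv at h
  split at h
  · split_ifs at h
    · simp at h
    · exact .inl h
  · split_ifs at h
    · simp_all
    · exact .inl h
  · split_ifs at h
    · simp at h
    · exact .inl h
  · exact .inl h

theorem ReaderState.recv_eq_putTag {C : Config V F} {σ : ReaderState W C}
    {j : Fin C.n₁} {m : Msg W R C} {q : ℕ} {t : Tag W} {v : V} {acks : Finset (Fin C.n₁)}
    (h : σ.recv j m = ⟨q, .putTag t v acks⟩) :
    σ = ⟨q, .putTag t v acks⟩ ∨ ∃ acks', σ = ⟨q, .putTag t v acks'⟩ ∧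
      m = .ackRead q ∧ acks = insert j acks' := by
  obtain ⟨qσ, ph⟩ := σ
  unfold ReaderState.recv at h
  split at h
  · split_ifs at h
    · simp at h
    · exact .inl h
  · split_ifs at h
    · simp at h
    · exact .inl h
  · split_ifs at h
    · simp_all
    · exact .inl h
  · exact .inl h

variable [LinearOrder W] [DecidableEq R] {C : Config V F}

/-! ### Freshness of queries and meaning of acknowledgements -/

/-- Soundness of a packet with respect to the operation numbers of the clients and the committed
tags. -/
structure Packet.Control (s : State W R C) (p : Packet W R C) : Prop where
  queryTag : ∀ w j q, p = ⟨.writer w, .edge j, .queryTag q⟩ → q ≤ (s.writers w).q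
  tagResp : ∀ w j q t, p = ⟨.edge j, .writer w, .tagResp q t⟩ → q ≤ (s.writers w).q
  queryCommTag : ∀ r j q, p = ⟨.reader r, .edge j, .queryCommTag q⟩ → q ≤ (s.readers r).q
  commTagResp : ∀ r j q t, p = ⟨.edge j, .reader r, .commTagResp q t⟩ → q ≤ (s.readers r).q
  ackWrite : ∀ w j t, p = ⟨.edge j, .writer w, .ackWrite t⟩ → t ≤ (s.edges j).tc
  putTag : ∀ r j q t, p = ⟨.reader r, .edge j, .putTag q t⟩ →
    ∃ v acks, (⟨q, .putTag t v acks⟩ : ReaderState W C).Progress (s.readers r)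
  ackRead : ∀ r j q, p = ⟨.edge j, .reader r, .ackRead q⟩ →
    ∃ t v acks, (⟨q, .putTag t v acks⟩ : ReaderState W C).Progress (s.readers r) ∧
      t ≤ (s.edges j).tc

omit [DecidableEq R] in
theorem Packet.Control.mono {s s' : State W R C} (h : s.Progress s') {p : Packet W R C}
    (hp : p.Control s) : p.Control s' where
  queryTag w j q e := (hp.queryTag w j q e).trans (h.writer w).q_le
  tagResp w j q t e := (hp.tagResp w j q t e).trans (h.writer w).q_le
  queryCommTag r j q e := (hp.queryCommTag r j q e).trans (h.reader r).q_le
  commTagResp r j q t e := (hp.commTagResp r j q t e).trans (h.reader r).q_le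
  ackWrite w j t e := (hp.ackWrite w j t e).trans (h.edge j)
  putTag r j q t e :=
    let ⟨v, acks, hr⟩ := hp.putTag r j q t e
    ⟨v, acks, hr.trans (h.reader r)⟩
  ackRead r j q e :=
    let ⟨t, v, acks, hr, ht⟩ := hp.ackRead r j q e
    ⟨t, v, acks, hr.trans (h.reader r), ht.trans (h.edge j)⟩

-- An answer repeats the operation number of the request that caused it and returns to its sender,
-- so its freshness is inherited from the request.
omit [DecidableEq R] in
theorem Packet.Control.of_answer {s s' : State W R C} (h : s.Progress s') {src : Proc W R C}
    {j : Fin C.n₁} {m : Msg W R C} (hm : (⟨src, .edge j, m⟩ : Packet W R C).Control s)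
    {p : Packet W R C} (hsrc : p.src = .edge j)
    (hp : AnswerSound (s'.edges j).tc src m p) : p.Control s' := by
  replace hm := hm.mono h
  obtain ⟨h1, h2, h3, h4⟩ := hp
  constructor
  · rintro w j' q rfl
    simp at hsrc
  · rintro w j' q t rfl
    obtain ⟨rfl, rfl, -⟩ := h1 q t rfl
    exact hm.queryTag w j q rfl
  · rintro w j' q rfl
    simp at hsrc
  · rintro w j' q t rfl
    obtain ⟨rfl, rfl, -⟩ := h2 q t rfl
    exact hm.queryCommTag w j q rfl
  · rintro w j' t rfl
    obtain rfl : j' = j := by simpa using hsrc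
    exact h3 t rfl
  · rintro w j' q t rfl
    simp at hsrc
  · rintro r j' q rfl
    obtain rfl : j' = j := by simpa using hsrc
    obtain ⟨t, rfl, rfl, ht⟩ := h4 q rfl
    obtain ⟨v, acks, hr⟩ := hm.putTag r j' q t rfl
    exact ⟨t, v, acks, hr, ht⟩

/-- Freshness of the answers to clients, and meaning of acknowledgements: the server has committed a
tag at least as large. -/
structure State.Control (s : State W R C) : Prop where
  tcMem : ∀ j, (s.edges j).TcMem
  net : ∀ p ∈ s.net, p.Control s
  writer : ∀ w q t acks, s.writers w = ⟨q, .putData t acks⟩ →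
    1 ≤ tagZ t ∧ tagW t = w ∧ ∀ j ∈ acks, t ≤ (s.edges j).tc
  reader : ∀ r q t v acks, s.readers r = ⟨q, .putTag t v acks⟩ → ∀ j ∈ acks, t ≤ (s.edges j).tc

omit [DecidableEq R] in
theorem State.control_start (w₀ : W) : (State.start W R C w₀).Control where
  tcMem _ := ⟨none, rfl⟩
  net p hp := by simp [State.start] at hp
  writer w q t acks h := by simp [State.start] at h
  reader r q t v acks h := by simp [State.start] at h

theorem Step.control_net {s s' : State W R C} {a : Action W R C} (h : Step s a s')
    (hs : s.Control) : ∀ p ∈ s'.net, p.Control s' := by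
  have hP := h.progress
  have old : ∀ p ∈ s.net, p.Control s' := fun p hp => (hs.net p hp).mono hP
  have old' : ∀ {x net}, s.net = x ::ₘ net → ∀ p ∈ net, p.Control s' := fun hn p hp =>
    old p (hn ▸ Multiset.mem_cons_of_mem hp)
  cases h with
  | invokeWrite w v hc =>
    intro p hp
    rcases Multiset.mem_add.1 hp with hp | hp
    · exact old p hp
    · obtain ⟨j, rfl⟩ := mem_toEdges.1 hp
      constructor <;> simp
  | startPutData w q v resps t hc hs ht =>
    intro p hp
    rcases Multiset.mem_add.1 hp with hp | hp
    · exact old p hp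
    · obtain ⟨j, rfl⟩ := mem_toEdges.1 hp
      constructor <;> simp
  | invokeRead r hc =>
    intro p hp
    rcases Multiset.mem_add.1 hp with hp | hp
    · exact old p hp
    · obtain ⟨j, rfl⟩ := mem_toEdges.1 hp
      constructor <;> simp
  | startGetData r q resps t hc hs _ =>
    intro p hp
    rcases Multiset.mem_add.1 hp with hp | hp
    · exact old p hp
    · obtain ⟨j, rfl⟩ := mem_toEdges.1 hp
      constructor <;> simp
  | startPutTag r q treq resps t v hc hs hq ha hm =>
    intro p hp
    rcases Multiset.mem_add.1 hp with hp | hp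
    · exact old p hp
    · obtain ⟨j, rfl⟩ := mem_toEdges.1 hp
      constructor
      case putTag =>
        intro r' j' q' t' e
        simp only [Packet.mk.injEq, Proc.reader.injEq, Proc.edge.injEq, Msg.putTag.injEq] at e
        obtain ⟨rfl, rfl, rfl, rfl⟩ := e
        -- The reader enters the put-tag phase in this step, with no acknowledgements yet.
        exact ⟨v, ∅, by simpa using .refl _⟩
      all_goals simp
  | recvWriter j w m net hc hn => exact old' hn
  | recvReader j r m net hc hn => exact old' hn
  | recvEdge src j m net out σ' hc hn h =>
    intro p hp
    rcases Multiset.mem_add.1 hp with hp | hp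
    · exact old' hn p hp
    · refine Packet.Control.of_answer (j := j) hP (hs.net ⟨src, .edge j, m⟩ ?_) (h.src_eq hp) ?_
      · simp [hn]
      · simpa using h.answerSound (hs.tcMem j) hp
  | recvBack j i m net out σ' hc hn h =>
    cases h <;>
    · intro p hp
      rcases Multiset.mem_add.1 hp with hp | hp
      · exact old' hn p hp
      · obtain rfl := Multiset.mem_singleton.1 hp
        constructor <;> simp
  | _ => exact old

/-- Recorded acknowledgements stay meaningful because committed tags only grow; a new one takes its
meaning from the packet that carries it. -/
theorem Step.control {s s' : State W R C} {a : Action W R C} (h : Step s a s')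
    (hs : s.Control) : s'.Control := by
  have hnet := h.control_net hs
  have hP := h.progress
  have hw : ∀ w q t acks, s.writers w = ⟨q, .putData t acks⟩ →
      1 ≤ tagZ t ∧ tagW t = w ∧ ∀ j ∈ acks, t ≤ (s'.edges j).tc := fun w q t acks e =>
    let ⟨h1, h2, h3⟩ := hs.writer w q t acks e
    ⟨h1, h2, fun j hj => (h3 j hj).trans (hP.edge j)⟩
  have hr : ∀ r q t v acks, s.readers r = ⟨q, .putTag t v acks⟩ →
      ∀ j ∈ acks, t ≤ (s'.edges j).tc := fun r q t v acks e j hj =>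
    (hs.reader r q t v acks e j hj).trans (hP.edge j)
  cases h with
  | invokeWrite w v hc =>
    refine ⟨hs.tcMem, hnet, fun w' q t acks e => ?_, hr⟩
    simp only [Function.update_apply] at e
    split_ifs at e
    · simp at e
    · exact hw w' q t acks e
  | startPutData w q v resps t hc h ht =>
    refine ⟨hs.tcMem, hnet, fun w' q t acks e => ?_, hr⟩
    simp only [Function.update_apply] at e
    split_ifs at e with hw'
    · simp only [WriterState.mk.injEq, WriterPhase.putData.injEq] at e
      obtain ⟨-, rfl, rfl⟩ := e
      -- The successor in `newTag` keeps the tags of writes apart from the initial tag.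
      exact ⟨Nat.le_add_left _ _, hw'.symm, by simp⟩
    · exact hw w' q t acks e
  | respondWrite w q t acks hc h ha =>
    refine ⟨hs.tcMem, hnet, fun w' q t acks e => ?_, hr⟩
    simp only [Function.update_apply] at e
    split_ifs at e
    · simp at e
    · exact hw w' q t acks e
  | invokeRead r hc =>
    refine ⟨hs.tcMem, hnet, hw, fun r' q t v acks e => ?_⟩
    simp only [Function.update_apply] at e
    split_ifs at e
    · simp at e
    · exact hr r' q t v acks e
  | startGetData r q resps t hc h _ =>
    refine ⟨hs.tcMem, hnet, hw, fun r' q t v acks e => ?_⟩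
    simp only [Function.update_apply] at e
    split_ifs at e
    · simp at e
    · exact hr r' q t v acks e
  | startPutTag r q treq resps t v hc h hq ha hm =>
    refine ⟨hs.tcMem, hnet, hw, fun r' q t v acks e => ?_⟩
    simp only [Function.update_apply] at e
    split_ifs at e
    · simp only [ReaderState.mk.injEq, ReaderPhase.putTag.injEq] at e
      obtain ⟨-, rfl, rfl, rfl⟩ := e
      simp
    · exact hr r' q t v acks e
  | respondRead r q t v acks hc h ha =>
    refine ⟨hs.tcMem, hnet, hw, fun r' q t v acks e => ?_⟩
    simp only [Function.update_apply] at e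
    split_ifs at e
    · simp at e
    · exact hr r' q t v acks e
  | recvWriter j w m net hc hn =>
    refine ⟨hs.tcMem, hnet, fun w' q t acks e => ?_, hr⟩
    simp only [Function.update_apply] at e
    split_ifs at e with hw'
    · subst hw'
      rcases WriterState.recv_eq_putData e with e' | ⟨acks', e', rfl, rfl⟩
      · exact hw w' q t acks e'
      · obtain ⟨h1, h2, h3⟩ := hw w' q t acks' e'
        refine ⟨h1, h2, fun j' hj' => ?_⟩
        rcases Finset.mem_insert.1 hj' with rfl | hj'
        · exact (hs.net ⟨.edge j', .writer w', .ackWrite t⟩ (by simp [hn])).ackWrite w' j' t rfl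
        · exact h3 j' hj'
    · exact hw w' q t acks e
  | recvReader j r m net hc hn =>
    refine ⟨hs.tcMem, hnet, hw, fun r' q t v acks e => ?_⟩
    simp only [Function.update_apply] at e
    split_ifs at e with hr'
    · subst hr'
      rcases ReaderState.recv_eq_putTag e with e' | ⟨acks', e', rfl, rfl⟩
      · exact hr r' q t v acks e'
      · intro j' hj'
        rcases Finset.mem_insert.1 hj' with rfl | hj'
        · obtain ⟨t', v', acks'', hp, ht⟩ :=
            (hs.net ⟨.edge j', .reader r', .ackRead q⟩ (by simp [hn])).ackRead r' j' q rfl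
          rw [e'] at hp
          -- The acknowledgement names only the operation number. The packet invariant gives some
          -- tag `t'` written back under that number, and `Progress` freezes this tag while the
          -- number is unchanged.
          obtain rfl : t = t' := by
            rcases hp with hp | ⟨-, -, hp⟩
            · simp at hp
            · rcases hp t' v' acks'' rfl with hp | ⟨_, hp⟩
              · simp at hp
              · simp at hp
                exact hp.1
          exact ht
        · exact hr r' q t v acks' e' j' hj'
    · exact hr r' q t v acks e
  | recvEdge src j m net out σ' hc hn h =>
    refine ⟨fun j' => ?_, hnet, hw, hr⟩
    by_cases hj : j' = j
    · subst hj
      simpa using h.tcMem (hs.tcMem j')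
    · simpa [Function.update_of_ne hj] using hs.tcMem j'
  | recvBack j i m net out σ' hc hn h => exact ⟨hs.tcMem, hnet, hw, hr⟩
  | crash p => exact ⟨hs.tcMem, hnet, hw, hr⟩

end LDS

/-! ### Quorum intersection and its consequences for later operations -/

namespace LDS

variable {W R V F : Type*}

/-- The two sizes add up to at least `2 * f₁ + 2 * k = n₁ + k`, which exceeds `n₁`. -/
theorem exists_of_quorum {C : Config V F} {S : Finset (Fin C.n₁)} (hS : C.f₁ + C.k ≤ S.card)
    {A : Set (Fin C.n₁)} (hA : C.f₁ + C.k ≤ A.ncard) : ∃ j ∈ S, j ∈ A := by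
  classical
  -- Positivity of `k` is exactly the hypothesis `2 * f₁ < n₁`.
  have hk : 0 < C.k := by have := C.f₁_lt; have := C.n₁_eq; omega
  have hA' : A.ncard = A.toFinset.card := Set.ncard_eq_toFinset_card' A
  have hlt : Fintype.card (Fin C.n₁) < S.card + A.toFinset.card := by
    have := C.n₁_eq
    rw [Fintype.card_fin]
    omega
  have hne : (S ∩ A.toFinset).Nonempty := by
    rw [← Finset.card_pos]
    have h1 := Finset.card_union_add_card_inter S A.toFinset
    have h2 := Finset.card_le_univ (S ∪ A.toFinset)
    omega
  obtain ⟨j, hj⟩ := hne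
  rw [Finset.mem_inter, Set.mem_toFinset] at hj
  exact ⟨j, hj.1, hj.2⟩

/-- One server of `S` is among those that answered, and the maximum dominates its answer; answers
from outside `S` need no bound. -/
theorem QuorumMax.le [LinearOrder W] {C : Config V F} {S : Finset (Fin C.n₁)}
    (hS : C.f₁ + C.k ≤ S.card) {resps : Fin C.n₁ → Option (Tag W)} {t T : Tag W}
    (ht : QuorumMax C resps t) (h : ∀ j ∈ S, ∀ u, resps j = some u → T ≤ u) : T ≤ t := by
  obtain ⟨j, hj, hr⟩ := exists_of_quorum hS ht.1
  obtain ⟨u, hu⟩ := Option.ne_none_iff_exists'.1 hr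
  exact (h j hj u hu).trans (ht.2.2 ⟨j, hu⟩)

variable [LinearOrder W] [DecidableEq R] {C : Config V F}

/-! ### Operations that begin after a quorum has committed a tag -/

/-- Everything known to the operation `q` of the writer `w` from the servers in `S` reflects
that these have committed the tag `T`. -/
structure State.WriteAfter (S : Finset (Fin C.n₁)) (T : Tag W) (w : W) (q : ℕ)
    (s : State W R C) : Prop where
  edge : ∀ j ∈ S, T ≤ (s.edges j).tc
  net : ∀ j ∈ S, ∀ t, ⟨.edge j, .writer w, .tagResp q t⟩ ∈ s.net → T ≤ t
  resps : ∀ v resps, s.writers w = ⟨q, .getTag v resps⟩ →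
    ∀ j ∈ S, ∀ t, resps j = some t → T ≤ t
  tag : ∀ t acks, s.writers w = ⟨q, .putData t acks⟩ → T < t

/-- Everything known to the operation `q` of the reader `r` from the servers in `S` reflects
that these have committed the tag `T`. -/
structure State.ReadAfter (S : Finset (Fin C.n₁)) (T : Tag W) (r : R) (q : ℕ)
    (s : State W R C) : Prop where
  edge : ∀ j ∈ S, T ≤ (s.edges j).tc
  net : ∀ j ∈ S, ∀ t, ⟨.edge j, .reader r, .commTagResp q t⟩ ∈ s.net → T ≤ t
  resps : ∀ resps, s.readers r = ⟨q, .getCommTag resps⟩ →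
    ∀ j ∈ S, ∀ t, resps j = some t → T ≤ t
  treq : ∀ t resps, s.readers r = ⟨q, .getData t resps⟩ → T ≤ t
  tag : ∀ t v acks, s.readers r = ⟨q, .putTag t v acks⟩ → T ≤ t

-- Start of the invariant: before operation `q` is invoked, freshness excludes answers to it in
-- transit, and no phase carries its number, so all clauses but the first are vacuous.
omit [DecidableEq R] in
theorem State.Control.writeAfter {s : State W R C} (hs : s.Control) {S : Finset (Fin C.n₁)}
    {T : Tag W} (hT : ∀ j ∈ S, T ≤ (s.edges j).tc) {w : W} {q : ℕ} (hq : (s.writers w).q < q) :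
    s.WriteAfter S T w q where
  edge := hT
  net j hj t hp := absurd ((hs.net _ hp).tagResp w j q t rfl) hq.not_ge
  resps v resps e := by simp [e] at hq
  tag t acks e := by simp [e] at hq

omit [DecidableEq R] in
theorem State.Control.readAfter {s : State W R C} (hs : s.Control) {S : Finset (Fin C.n₁)}
    {T : Tag W} (hT : ∀ j ∈ S, T ≤ (s.edges j).tc) {r : R} {q : ℕ} (hq : (s.readers r).q < q) :
    s.ReadAfter S T r q where
  edge := hT
  net j hj t hp := absurd ((hs.net _ hp).commTagResp r j q t rfl) hq.not_ge
  resps resps e := by simp [e] at hq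
  treq t resps e := by simp [e] at hq
  tag t v acks e := by simp [e] at hq

/-- A step other than that of an edge server sends no answers to the queries of clients. -/
theorem Step.mem_net {s s' : State W R C} {a : Action W R C} (h : Step s a s') (hs : s.Control)
    {j : Fin C.n₁} {dst : Proc W R C} {m : Msg W R C} (hp : ⟨.edge j, dst, m⟩ ∈ s'.net) :
    ⟨.edge j, dst, m⟩ ∈ s.net ∨
      ∃ src m', AnswerSound (s'.edges j).tc src m' ⟨.edge j, dst, m⟩ := by
  cases h with
  | invokeWrite | startPutData | invokeRead | startGetData | startPutTag =>
    left
    simpa [mem_toEdges] using hp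
  | recvWriter j' w m' net hc hn => exact .inl (hn ▸ Multiset.mem_cons_of_mem hp)
  | recvReader j' r m' net hc hn => exact .inl (hn ▸ Multiset.mem_cons_of_mem hp)
  | recvEdge src j' m' net out σ' hc hn h =>
    rcases Multiset.mem_add.1 hp with hp' | hp'
    · exact .inl (hn ▸ Multiset.mem_cons_of_mem hp')
    · obtain rfl : j = j' := by simpa using h.src_eq hp'
      exact .inr ⟨src, m', by simpa using h.answerSound (hs.tcMem j) hp'⟩
  | recvBack j' i m' net out σ' hc hn h =>
    rcases Multiset.mem_add.1 hp with hp' | hp'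
    · exact .inl (hn ▸ Multiset.mem_cons_of_mem hp')
    · cases h <;> simp at hp'
  | _ => exact .inl hp

/-- Servers in `S` keep committed tags `≥ T`, so their new answers report at least `T`. The quorum
behind the maximum meets `S`, and passing to `newTag` makes the inequality strict. -/
theorem Step.writeAfter {s s' : State W R C} {a : Action W R C} (h : Step s a s') (hs : s.Control)
    {S : Finset (Fin C.n₁)} (hS : C.f₁ + C.k ≤ S.card) {T : Tag W} {w : W} {q : ℕ}
    (hw : s.WriteAfter S T w q) : s'.WriteAfter S T w q := by
  have hedge : ∀ j ∈ S, T ≤ (s'.edges j).tc := fun j hj => (hw.edge j hj).trans (h.progress.edge j)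
  have hnet : ∀ j ∈ S, ∀ t, ⟨.edge j, .writer w, .tagResp q t⟩ ∈ s'.net → T ≤ t := by
    intro j hj t hp
    rcases h.mem_net hs hp with hp | ⟨src, m, hm⟩
    · exact hw.net j hj t hp
    · exact (hedge j hj).trans (hm.1 q t rfl).2.2
  have hresps := hw.resps
  have htag := hw.tag
  refine ⟨hedge, hnet, ?_, ?_⟩
  · cases h with
    | invokeWrite w' v hc =>
      intro v' resps e
      simp only [Function.update_apply] at e
      split_ifs at e
      · simp at e
        simp [← e.2.2]
      · exact hresps v' resps e
    | startPutData w' q v resps t hc h ht =>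
      intro v' resps e
      simp only [Function.update_apply] at e
      split_ifs at e
      · simp at e
      · exact hresps v' resps e
    | respondWrite w' q t acks hc h ha =>
      intro v' resps e
      simp only [Function.update_apply] at e
      split_ifs at e
      · simp at e
      · exact hresps v' resps e
    | recvWriter j w' m net hc hn =>
      intro v' resps e
      simp only [Function.update_apply] at e
      split_ifs at e with hw'
      · subst hw'
        rcases WriterState.recv_eq_getTag e with e' | ⟨resps', t, e', rfl, rfl⟩
        · exact hresps v' resps e'
        · intro j' hj' u hu
          simp only [Function.update_apply] at hu
          split_ifs at hu with hj
          · subst hj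
            obtain rfl : t = u := by simpa using hu
            exact hw.net j' hj' t (by simp [hn])
          · exact hresps v' resps' e' j' hj' u hu
      · exact hresps v' resps e
    | _ => exact hresps
  · cases h with
    | invokeWrite w' v hc =>
      intro t acks e
      simp only [Function.update_apply] at e
      split_ifs at e
      · simp at e
      · exact htag t acks e
    | startPutData w' q v resps t hc h ht =>
      intro t' acks e
      simp only [Function.update_apply] at e
      split_ifs at e with hw'
      · subst hw'
        simp only [WriterState.mk.injEq, WriterPhase.putData.injEq] at e
        obtain ⟨rfl, rfl, -⟩ := e
        exact (ht.le hS (hresps v resps h)).trans_lt (lt_newTag t w)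
      · exact htag t' acks e
    | respondWrite w' q t acks hc h ha =>
      intro t acks e
      simp only [Function.update_apply] at e
      split_ifs at e
      · simp at e
      · exact htag t acks e
    | recvWriter j w' m net hc hn =>
      intro t acks e
      simp only [Function.update_apply] at e
      split_ifs at e with hw'
      · subst hw'
        rcases WriterState.recv_eq_putData e with e' | ⟨acks', e', -, -⟩
        · exact htag t acks e'
        · exact htag t acks' e'
      · exact htag t acks e
    | _ => exact htag

/-- As for writes up to the requested tag, but without a strict increase. The answers in the data
phase need no tracking, since availability itself demands a tag at least the requested one. -/
theorem Step.readAfter {s s' : State W R C} {a : Action W R C} (h : Step s a s') (hs : s.Control)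
    {S : Finset (Fin C.n₁)} (hS : C.f₁ + C.k ≤ S.card) {T : Tag W} {r : R} {q : ℕ}
    (hr : s.ReadAfter S T r q) : s'.ReadAfter S T r q := by
  have hedge : ∀ j ∈ S, T ≤ (s'.edges j).tc := fun j hj => (hr.edge j hj).trans (h.progress.edge j)
  have hnet : ∀ j ∈ S, ∀ t, ⟨.edge j, .reader r, .commTagResp q t⟩ ∈ s'.net → T ≤ t := by
    intro j hj t hp
    rcases h.mem_net hs hp with hp | ⟨src, m, hm⟩
    · exact hr.net j hj t hp
    · exact (hedge j hj).trans (hm.2.1 q t rfl).2.2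
  have hresps := hr.resps
  have htreq := hr.treq
  have htag := hr.tag
  cases h with
  | invokeRead r' hc =>
    refine ⟨hedge, hnet, fun resps e => ?_, fun t resps e => ?_, fun t v acks e => ?_⟩ <;>
      simp only [Function.update_apply] at e <;> split_ifs at e
    · simp at e
      simp [← e.2]
    · exact hresps resps e
    · simp at e
    · exact htreq t resps e
    · simp at e
    · exact htag t v acks e
  | startGetData r' q' resps' t' hc h ht =>
    refine ⟨hedge, hnet, fun resps e => ?_, fun t resps e => ?_, fun t v acks e => ?_⟩ <;>
      simp only [Function.update_apply] at e <;> split_ifs at e with hr'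
    · simp at e
    · exact hresps resps e
    · subst hr'
      simp only [ReaderState.mk.injEq, ReaderPhase.getData.injEq] at e
      obtain ⟨rfl, rfl, -⟩ := e
      exact ht.le hS (hresps resps' h)
    · exact htreq t resps e
    · simp at e
    · exact htag t v acks e
  | startPutTag r' q' treq' resps' t' v' hc h hq ha hm =>
    refine ⟨hedge, hnet, fun resps e => ?_, fun t resps e => ?_, fun t v acks e => ?_⟩ <;>
      simp only [Function.update_apply] at e <;> split_ifs at e with hr'
    · simp at e
    · exact hresps resps e
    · simp at e
    · exact htreq t resps e
    · subst hr'
      simp only [ReaderState.mk.injEq, ReaderPhase.putTag.injEq] at e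
      obtain ⟨rfl, rfl, -, -⟩ := e
      -- `ha.1` is the demand that the selected tag be at least the requested one.
      exact (htreq treq' resps' h).trans ha.1
    · exact htag t v acks e
  | respondRead r' q' t' v' acks' hc h ha =>
    refine ⟨hedge, hnet, fun resps e => ?_, fun t resps e => ?_, fun t v acks e => ?_⟩ <;>
      simp only [Function.update_apply] at e <;> split_ifs at e with hr'
    · simp at e
    · exact hresps resps e
    · simp at e
    · exact htreq t resps e
    · simp at e
    · exact htag t v acks e
  | recvReader j r' m net hc hn =>
    refine ⟨hedge, hnet, fun resps e => ?_, fun t resps e => ?_, fun t v acks e => ?_⟩ <;>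
      simp only [Function.update_apply] at e <;> split_ifs at e with hr'
    · subst hr'
      rcases ReaderState.recv_eq_getCommTag e with e' | ⟨resps', t, e', rfl, rfl⟩
      · exact hresps resps e'
      · intro j' hj' u hu
        simp only [Function.update_apply] at hu
        split_ifs at hu with hj
        · subst hj
          obtain rfl : t = u := by simpa using hu
          exact hr.net j' hj' t (by simp [hn])
        · exact hresps resps' e' j' hj' u hu
    · exact hresps resps e
    · subst hr'
      rcases ReaderState.recv_eq_getData e with e' | ⟨resps', x, e', -, -⟩
      · exact htreq t resps e'
      · exact htreq t resps' e'
    · exact htreq t resps e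
    · subst hr'
      rcases ReaderState.recv_eq_putTag e with e' | ⟨acks', e', -, -⟩
      · exact htag t v acks e'
      · exact htag t v acks' e'
    · exact htag t v acks e
  | _ => exact ⟨hedge, hnet, hresps, htreq, htag⟩

end LDS

namespace LDS

variable {W R V F : Type*} {C : Config V F}

/-! ### Consistency of values and coded data -/

/-- The content of an answer of the edge server `j` to a reader is consistent with the assignment
`Val` of values to tags. -/
def DataResp.Sound (Val : Tag W → V → Prop) (j : Fin C.n₁) : DataResp W C → Prop
  | .value t v => Val t v
  | .coded t c => ∃ v, Val t v ∧ c = C.code.encode (C.file v) (Fin.castAdd C.n₂ j)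
  | .failed => True

/-- The element `h` received by the edge server `j` from the back-end server `i` is the helper data
for `j` of a value assigned to the tag `t`. -/
def HelperSound (Val : Tag W → V → Prop) (j : Fin C.n₁) (t : Tag W) (i : Fin C.n₂)
    (h : Fin C.β → F) : Prop :=
  ∃ v, Val t v ∧
    h = C.code.helper (Fin.natAdd C.n₁ i) (Fin.castAdd C.n₂ j) (backSymbol C v i)

/-- The symbol `c` is that of the back-end server `i` for a value assigned to the tag `t`. -/
def SymbolSound (C : Config V F) (Val : Tag W → V → Prop) (t : Tag W) (i : Fin C.n₂)
    (c : Fin C.α → F) : Prop :=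
  ∃ v, Val t v ∧ c = backSymbol C v i

/-- The data carried by a packet is consistent with `Val`. -/
structure Packet.Sound (Val : Tag W → V → Prop) (p : Packet W R C) : Prop where
  putData : ∀ t v, p.msg = .putData t v → Val t v
  dataResp : ∀ j q x, p.src = .edge j → p.msg = .dataResp q x → x.Sound Val j
  writeCodeElem : ∀ i t c, p.dst = .back i → p.msg = .writeCodeElem t c → SymbolSound C Val t i c
  sendHelperElem : ∀ i j ρ t h, p.src = .back i → p.dst = .edge j → p.msg = .sendHelperElem ρ t h →
    HelperSound Val j t i h

/-- The data stored by the edge server `j` is consistent with `Val`. -/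
structure EdgeState.Sound (Val : Tag W → V → Prop) (j : Fin C.n₁) (σ : EdgeState W R C) :
    Prop where
  list : ∀ t v, (t, some v) ∈ σ.L → Val t v
  helpers : ∀ ρ t i h, (t, i, h) ∈ σ.K ρ → HelperSound Val j t i h

variable [LinearOrder W] [DecidableEq R] {Val : Tag W → V → Prop}

theorem mem_of_mem_dropBelow {L : Set (Tag W × Option V)} {t u : Tag W} {v : V}
    (h : (u, some v) ∈ dropBelow L t) : (u, some v) ∈ L := by
  rcases h with h | ⟨-, h, -⟩
  · exact h.1
  · simp at h

/-- Values enter a list only through put-data messages, and helper data only through helper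
messages; garbage collection merely erases. -/
theorem EdgeRecv.edgeSound {j : Fin C.n₁} {σ σ' : EdgeState W R C} {src : Proc W R C}
    {m : Msg W R C} {out : Multiset (Packet W R C)} (h : EdgeRecv j σ src m σ' out)
    (hσ : σ.Sound Val j) (hm : (⟨src, .edge j, m⟩ : Packet W R C).Sound Val) :
    σ'.Sound Val j := by
  obtain ⟨hL, hK⟩ := hσ
  cases h with
  | putDataNew w t v ht =>
    refine ⟨fun u x hu => ?_, hK⟩
    rcases hu with hu | hu
    · exact hL u x hu
    · obtain ⟨rfl, rfl⟩ : u = t ∧ x = v := by simpa using hu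
      exact hm.putData _ _ rfl
  | commitNew _ t v hv h ht => exact ⟨fun u x hu => hL u x (mem_of_mem_dropBelow hu), hK⟩
  | ackCodeDone i t h =>
    refine ⟨fun u x hu => ?_, hK⟩
    rcases hu with hu | hu
    · exact hL u x hu.1
    · simp at hu
  | helperWait i ρ t h hn =>
    refine ⟨hL, fun ρ' t' i' h' hx => ?_⟩
    simp only [Function.update_apply] at hx
    split_ifs at hx
    · rcases hx with hx | hx
      · exact hK _ t' i' h' hx
      · obtain ⟨rfl, rfl, rfl⟩ : t' = t ∧ i' = i ∧ h' = h := by simpa using hx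
        exact hm.sendHelperElem _ _ _ _ _ rfl rfl rfl
    · exact hK ρ' t' i' h' hx
  | helperDone i ρ t h res hn hres =>
    refine ⟨hL, fun ρ' t' i' h' hx => ?_⟩
    simp only [Function.update_apply] at hx
    split_ifs at hx
    · exact hx.elim
    · exact hK ρ' t' i' h' hx
  | putTagValue r q t v ht hv => exact ⟨fun u x hu => hL u x (mem_of_mem_dropBelow hu), hK⟩
  | putTagOlder r q t t' v' ht hv ht' hv' =>
    refine ⟨fun u x hu => ?_, hK⟩
    rcases mem_of_mem_dropBelow hu with hu | hu
    · exact hL u x hu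
    · simp at hu
  | putTagNone r q t ht hv hn =>
    refine ⟨fun u x hu => ?_, hK⟩
    rcases mem_of_mem_dropBelow hu with hu | hu
    · exact hL u x hu
    · simp at hu
  | _ => exact ⟨hL, hK⟩

omit [LinearOrder W] [DecidableEq R] in
theorem Packet.Sound.of_answer {j : Fin C.n₁} {r : R} {q : ℕ} {x : DataResp W C}
    (hx : x.Sound Val j) : (⟨.edge j, .reader r, .dataResp q x⟩ : Packet W R C).Sound Val := by
  constructor <;> simp
  exact hx

omit [DecidableEq R] in
theorem sound_of_mem_serve {j : Fin C.n₁} {Γ : Finset ((R × ℕ) × Tag W)} {t : Tag W} {v : V}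
    (hv : Val t v) {p : Packet W R C} (hp : p ∈ serve j Γ t v) : p.Sound Val := by
  obtain ⟨γ, -, rfl⟩ := Multiset.mem_map.1 hp
  exact .of_answer hv

omit [LinearOrder W] [DecidableEq R] in
theorem sound_of_mem_writeToL2 {j : Fin C.n₁} {t : Tag W} {v : V}
    (hv : Val t v) {p : Packet W R C} (hp : p ∈ writeToL2 j t v) : p.Sound Val := by
  obtain ⟨i, rfl⟩ := mem_toBacks.1 hp
  constructor
  case writeCodeElem =>
    intro i' t' c' hi hc
    simp only [Proc.back.injEq, Msg.writeCodeElem.injEq] at hi hc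
    obtain ⟨rfl, rfl⟩ := hc
    subst hi
    exact ⟨v, hv, rfl⟩
  all_goals simp

/-- The chosen helpers share the tag `t`, and `Val` is functional, so their data come from one
codeword and exact repair applies. -/
theorem Regenerates.sound (hfun : ∀ t v v', Val t v → Val t v' → v = v') {j : Fin C.n₁}
    {K : Set (Tag W × Fin C.n₂ × (Fin C.β → F))} {res : Option (Tag W × (Fin C.α → F))}
    (h : Regenerates C j K res) (hK : ∀ t i h, (t, i, h) ∈ K → HelperSound Val j t i h)
    (treq : Tag W) : (regenAnswer treq res : DataResp W C).Sound Val j := by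
  match res, h with
  | none, _ => trivial
  | some (t, c), ⟨_, D, g, hD, hg, hc⟩ =>
    by_cases ht : treq ≤ t
    swap
    · simp [regenAnswer, ht, DataResp.Sound]
    simp only [regenAnswer, if_pos ht]
    -- From `3 * f₂ < 2 * f₂ + d`. At least one helper is needed to supply a value for `t`.
    have hd : 0 < C.d := by have := C.f₂_lt; have := C.n₂_eq; omega
    obtain ⟨i₀, hi₀⟩ := Finset.card_pos.1 (hD.symm ▸ hd)
    obtain ⟨v, hv, -⟩ := hK _ _ _ (hg i₀ hi₀)
    refine ⟨v, hv, ?_⟩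
    rw [hc]
    refine C.code.repair_eq _ _ _ _ (by simpa using hD) ?_ ?_
    -- The index under repair belongs to the edge layer, below `n₁`, while helpers have indices from
    -- `n₁` on.
    · simp only [Finset.mem_map, not_exists, not_and]
      intro i _ hi
      have := congrArg Fin.val hi
      simp at this
      omega
    · intro i hi
      obtain ⟨i', hi', rfl⟩ := Finset.mem_map.1 hi
      obtain ⟨v', hv', h'⟩ := hK _ _ _ (hg i' hi')
      obtain rfl := hfun t v v' hv hv'
      exact h'

theorem EdgeRecv.packetSound (hfun : ∀ t v v', Val t v → Val t v' → v = v') {j : Fin C.n₁}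
    {σ σ' : EdgeState W R C} {src : Proc W R C} {m : Msg W R C} {out : Multiset (Packet W R C)}
    (h : EdgeRecv j σ src m σ' out) (hσ : σ.Sound Val j)
    (hm : (⟨src, .edge j, m⟩ : Packet W R C).Sound Val) {p : Packet W R C} (hp : p ∈ out) :
    p.Sound Val := by
  obtain ⟨hL, hK⟩ := hσ
  cases h <;>
    try simp only [Multiset.mem_singleton, Multiset.mem_add, mem_toEdges, mem_toBacks,
      Multiset.notMem_zero] at hp
  case getTagResp => subst hp; constructor <;> simp
  case putDataNew => obtain ⟨_, rfl⟩ := hp; constructor <;> simp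
  case putDataOld => rcases hp with ⟨_, rfl⟩ | rfl <;> constructor <;> simp
  case commitOld => subst hp; constructor <;> simp
  case commitNew t v hv h ht =>
    rcases hp with (rfl | hp) | hp
    · constructor <;> simp
    · exact sound_of_mem_serve (hL t v hv) hp
    · exact sound_of_mem_writeToL2 (hL t v hv) hp
  case getCommTagResp => subst hp; constructor <;> simp
  case getDataReq r q t v hv => subst hp; exact .of_answer (hL _ _ hv)
  case getDataComm r q t v h ht hv => subst hp; exact .of_answer (hL _ _ hv)
  case getDataRegenerate => obtain ⟨_, rfl⟩ := hp; constructor <;> simp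
  case helperDone i ρ t h res hn hres =>
    obtain ⟨γ, -, rfl⟩ := Multiset.mem_map.1 hp
    refine .of_answer (hres.sound hfun (fun t' i' h' hx => ?_) _)
    rcases hx with hx | hx
    · exact hK ρ t' i' h' hx
    · obtain ⟨rfl, rfl, rfl⟩ : t' = t ∧ i' = i ∧ h' = h := by simpa using hx
      exact hm.sendHelperElem _ _ _ _ _ rfl rfl rfl
  case putTagOld => subst hp; constructor <;> simp
  case putTagValue r q t v ht hv =>
    rcases hp with (hp | hp) | rfl
    · exact sound_of_mem_serve (hL t v hv) hp
    · exact sound_of_mem_writeToL2 (hL t v hv) hp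
    · constructor <;> simp
  case putTagOlder r q t t' v' ht hv ht' hv' =>
    rcases hp with hp | rfl
    · exact sound_of_mem_serve (hL t' v' hv') hp
    · constructor <;> simp
  case putTagNone => subst hp; constructor <;> simp

/-- The `k` coded elements share a tag, hence by functionality of `Val` belong to one codeword, and
decoding recovers its file. -/
theorem Available.sound (hfun : ∀ t v v', Val t v → Val t v' → v = v') {treq t : Tag W} {v : V}
    {resps : Set (Fin C.n₁ × DataResp W C)} (h : Available treq resps t v)
    (hr : ∀ j x, (j, x) ∈ resps → x.Sound Val j) : Val t v := by
  rcases h.2 with ⟨j, hj⟩ | ⟨S, c, hS, hc, hv⟩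
  · exact hr j _ hj
  · have hk : 0 < C.k := by have := C.f₁_lt; have := C.n₁_eq; omega
    obtain ⟨j₀, hj₀⟩ := Finset.card_pos.1 (hS.symm ▸ hk)
    obtain ⟨u, hu, -⟩ := hr _ _ (hc j₀ hj₀)
    have : C.code.decode (S.map (Fin.castAddEmb C.n₂)) c = C.file u := by
      refine C.code.decode_eq _ _ _ (by simpa using hS) fun j hj => ?_
      obtain ⟨j', hj', rfl⟩ := Finset.mem_map.1 hj
      obtain ⟨u', hu', h'⟩ := hr _ _ (hc j' hj')
      obtain rfl := hfun t u u' hu hu'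
      exact h'
    -- The decoded file presents both `u` and `v`; the presentation of values is injective.
    obtain rfl := C.file.injective (this.symm.trans hv)
    exact hu

/-- All data in the system is consistent with `Val`. -/
structure State.Sound (Val : Tag W → V → Prop) (s : State W R C) : Prop where
  net : ∀ p ∈ s.net, p.Sound Val
  edge : ∀ j, (s.edges j).Sound Val j
  back : ∀ i, SymbolSound C Val (s.backs i).t i (s.backs i).c
  resps : ∀ r q treq resps, s.readers r = ⟨q, .getData treq resps⟩ →
    ∀ j x, (j, x) ∈ resps → x.Sound Val j
  result : ∀ r q t v acks, s.readers r = ⟨q, .putTag t v acks⟩ → Val t v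

omit [LinearOrder W] [DecidableEq R] in
theorem State.sound_start {w₀ : W} (h : Val (tag₀ w₀) C.v₀) :
    (State.start W R C w₀).Sound Val where
  net p hp := by simp [State.start] at hp
  edge j := ⟨fun t v hv => by simp [State.start] at hv, fun ρ t i h hv => hv.elim⟩
  back i := ⟨C.v₀, h, rfl⟩
  resps r q treq resps e := by simp [State.start] at e
  result r q t v acks e := by simp [State.start] at e

/-- A value is joined to a new tag only when a writer passes from `getTag` to `putData`; `hval`
isolates this one event, and all other data are copies or coded derivatives. -/
theorem Step.sound_net (hfun : ∀ t v v', Val t v → Val t v' → v = v') {s s' : State W R C}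
    {a : Action W R C} (h : Step s a s') (hs : s.Sound Val)
    (hval : ∀ w q v resps q' t acks, s.writers w = ⟨q, .getTag v resps⟩ →
      s'.writers w = ⟨q', .putData t acks⟩ → Val t v) : ∀ p ∈ s'.net, p.Sound Val := by
  have old' : ∀ {x net}, s.net = x ::ₘ net → ∀ p ∈ net, p.Sound Val := fun hn p hp =>
    hs.net p (hn ▸ Multiset.mem_cons_of_mem hp)
  cases h with
  | startPutData w q v resps t hc h ht =>
    intro p hp
    rcases Multiset.mem_add.1 hp with hp | hp
    · exact hs.net p hp
    · obtain ⟨j, rfl⟩ := mem_toEdges.1 hp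
      constructor
      case putData =>
        intro u x e
        simp only [Msg.putData.injEq] at e
        obtain ⟨rfl, rfl⟩ := e
        exact hval w q v resps q _ ∅ h (by simp)
      all_goals simp
  | invokeWrite | invokeRead | startGetData | startPutTag =>
    intro p hp
    rcases Multiset.mem_add.1 hp with hp | hp
    · exact hs.net p hp
    · obtain ⟨j, rfl⟩ := mem_toEdges.1 hp
      constructor <;> simp
  | recvWriter j w m net hc hn => exact old' hn
  | recvReader j r m net hc hn => exact old' hn
  | recvEdge src j m net out σ' hc hn h =>
    intro p hp
    rcases Multiset.mem_add.1 hp with hp | hp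
    · exact old' hn p hp
    · exact h.packetSound hfun (hs.edge j) (hs.net _ (by simp [hn])) hp
  | recvBack j i m net out σ' hc hn h =>
    have hi := hs.back i
    cases h <;>
    · intro p hp
      rcases Multiset.mem_add.1 hp with hp | hp
      · exact old' hn p hp
      · obtain rfl := Multiset.mem_singleton.1 hp
        constructor
        case sendHelperElem =>
          intro i' j' ρ' t' h' hi' hj' e
          simp only [Proc.back.injEq, Proc.edge.injEq, Msg.sendHelperElem.injEq, reduceCtorEq]
            at hi' hj' e
          try
            obtain ⟨rfl, rfl, rfl⟩ := e
            subst hi' hj'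
            obtain ⟨v, hv, hc⟩ := hi
            exact ⟨v, hv, by rw [hc]⟩
        all_goals simp
  | _ => exact hs.net

theorem Step.sound (hfun : ∀ t v v', Val t v → Val t v' → v = v') {s s' : State W R C}
    {a : Action W R C} (h : Step s a s') (hs : s.Sound Val)
    (hval : ∀ w q v resps q' t acks, s.writers w = ⟨q, .getTag v resps⟩ →
      s'.writers w = ⟨q', .putData t acks⟩ → Val t v) : s'.Sound Val := by
  have hnet := h.sound_net hfun hs hval
  obtain ⟨hn₀, hedge, hback, hresps, hresult⟩ := hs
  cases h with
  | invokeRead | respondRead =>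
    refine ⟨hnet, hedge, hback, fun r q treq resps e => ?_, fun r q t v acks e => ?_⟩ <;>
      simp only [Function.update_apply] at e <;> split_ifs at e
    · simp at e
    · exact hresps r q treq resps e
    · simp at e
    · exact hresult r q t v acks e
  | startGetData r' q' resps' t' hc h ht =>
    refine ⟨hnet, hedge, hback, fun r q treq resps e => ?_, fun r q t v acks e => ?_⟩ <;>
      simp only [Function.update_apply] at e <;> split_ifs at e
    · simp only [ReaderState.mk.injEq, ReaderPhase.getData.injEq] at e
      simp [← e.2.2]
    · exact hresps r q treq resps e
    · simp at e
    · exact hresult r q t v acks e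
  | startPutTag r' q' treq' resps' t' v' hc h hq ha hm =>
    refine ⟨hnet, hedge, hback, fun r q treq resps e => ?_, fun r q t v acks e => ?_⟩ <;>
      simp only [Function.update_apply] at e <;> split_ifs at e
    · simp at e
    · exact hresps r q treq resps e
    · simp only [ReaderState.mk.injEq, ReaderPhase.putTag.injEq] at e
      obtain ⟨-, rfl, rfl, -⟩ := e
      exact ha.sound hfun (hresps r' q' treq' resps' h)
    · exact hresult r q t v acks e
  | recvReader j r' m net hc hn =>
    refine ⟨hnet, hedge, hback, fun r q treq resps e => ?_, fun r q t v acks e => ?_⟩ <;>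
      simp only [Function.update_apply] at e <;> split_ifs at e with hr
    · subst hr
      rcases ReaderState.recv_eq_getData e with e' | ⟨resps', x, e', rfl, rfl⟩
      · exact hresps r q treq resps e'
      · intro j' x' hx
        rcases hx with hx | hx
        · exact hresps r q treq resps' e' j' x' hx
        · obtain ⟨rfl, rfl⟩ : j' = j ∧ x' = x := by simpa using hx
          exact (hn₀ ⟨.edge j', .reader r, .dataResp q x'⟩ (by simp [hn])).dataResp _ _ _ rfl rfl
    · exact hresps r q treq resps e
    · subst hr
      rcases ReaderState.recv_eq_putTag e with e' | ⟨acks', e', -, -⟩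
      · exact hresult r q t v acks e'
      · exact hresult r q t v acks' e'
    · exact hresult r q t v acks e
  | recvEdge src j m net out σ' hc hn h =>
    refine ⟨hnet, fun j' => ?_, hback, hresps, hresult⟩
    by_cases hj : j' = j
    · subst hj
      simpa using h.edgeSound (hedge j') (hn₀ _ (by simp [hn]))
    · simpa [Function.update_of_ne hj] using hedge j'
  | recvBack j i m net out σ' hc hn h =>
    refine ⟨hnet, hedge, fun i' => ?_, hresps, hresult⟩
    by_cases hi : i' = i
    · subst hi
      cases h with
      | writeNew t c ht =>
        simpa using (hn₀ ⟨.edge j, .back i', .writeCodeElem t c⟩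
          (by simp [hn])).writeCodeElem _ _ _ rfl rfl
      | _ => simpa using hback i'
    · simpa [Function.update_of_ne hi] using hback i'
  | _ => exact ⟨hnet, hedge, hback, hresps, hresult⟩

end LDS

namespace LDS

variable {W R V F : Type*} [LinearOrder W] [DecidableEq R] {C : Config V F}

/-! ### Tags and values of operations -/

theorem Step.writer_q {s s' : State W R C} {a : Action W R C} (h : Step s a s') (w : W) :
    (s'.writers w).q = (s.writers w).q ∧ (∀ v, a ≠ .invokeWrite w v) ∨
      ∃ v, a = .invokeWrite w v ∧ s'.writers w = ⟨(s.writers w).q + 1, .getTag v fun _ => none⟩ := by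
  cases h with
  | invokeWrite w' v hc =>
    by_cases hw : w = w'
    · subst hw
      exact .inr ⟨v, rfl, by simp⟩
    · exact .inl ⟨by simp [hw], by simp [Ne.symm hw]⟩
  | startPutData w' q v resps t hc h ht =>
    left
    by_cases hw : w = w'
    · subst hw
      simp [h]
    · simp [hw]
  | respondWrite w' q t acks hc h ha =>
    left
    by_cases hw : w = w'
    · subst hw
      simp [h]
    · simp [hw]
  | recvWriter j w' m net hc hn =>
    left
    by_cases hw : w = w'
    · subst hw
      simp [WriterState.recv_q]
    · simp [hw]
  | _ => simp

theorem Step.reader_q {s s' : State W R C} {a : Action W R C} (h : Step s a s') (r : R) :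
    (s'.readers r).q = (s.readers r).q ∧ a ≠ .invokeRead r ∨
      a = .invokeRead r ∧ (s'.readers r).q = (s.readers r).q + 1 := by
  cases h with
  | invokeRead r' hc =>
    by_cases hr : r = r'
    · subst hr
      exact .inr ⟨rfl, by simp⟩
    · exact .inl ⟨by simp [hr], by simp [Ne.symm hr]⟩
  | startGetData r' q v resps t hc h =>
    left
    by_cases hr : r = r'
    · subst hr
      simp_all
    · simp [hr]
  | startPutTag r' q treq resps t v hc h =>
    left
    by_cases hr : r = r'
    · subst hr
      simp [h]
    · simp [hr]
  | respondRead r' q t v acks hc h ha =>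
    left
    by_cases hr : r = r'
    · subst hr
      simp [h]
    · simp [hr]
  | recvReader j r' m net hc hn =>
    left
    by_cases hr : r = r'
    · subst hr
      simp [ReaderState.recv_q]
    · simp [hr]
  | _ => simp

/-- Used to trace a `getTag` phase back to the invocation that supplied its value. -/
theorem Step.getTag_eq {s s' : State W R C} {a : Action W R C} (h : Step s a s') {w : W} {q : ℕ}
    {v : V} {resps : Fin C.n₁ → Option (Tag W)} (e : s'.writers w = ⟨q, .getTag v resps⟩) :
    (∃ resps', s.writers w = ⟨q, .getTag v resps'⟩) ∨
      a = .invokeWrite w v ∧ q = (s.writers w).q + 1 := by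
  cases h with
  | invokeWrite w' v' hc =>
    simp only [Function.update_apply] at e
    split_ifs at e with hw
    · subst hw
      simp only [WriterState.mk.injEq, WriterPhase.getTag.injEq] at e
      obtain ⟨rfl, rfl, -⟩ := e
      exact .inr ⟨rfl, rfl⟩
    · exact .inl ⟨_, e⟩
  | startPutData | respondWrite =>
    simp only [Function.update_apply] at e
    split_ifs at e
    · simp at e
    · exact .inl ⟨_, e⟩
  | recvWriter j w' m net hc hn =>
    simp only [Function.update_apply] at e
    split_ifs at e with hw
    · subst hw
      rcases WriterState.recv_eq_getTag e with e' | ⟨resps', t, e', -, -⟩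
      · exact .inl ⟨_, e'⟩
      · exact .inl ⟨_, e'⟩
    · exact .inl ⟨_, e⟩
  | _ => exact .inl ⟨_, e⟩

/-! ### Invariants along an execution; tags, values and responses of operations -/

namespace Execution

variable {w₀ : W} (e : Execution W R C w₀)

/-- The induction may start at any time `i`, because the invariants about later operations hold only
from the moment of commitment. -/
theorem invariant {P : State W R C → Prop} {i m : ℕ} (him : i ≤ m) (hm : (m : ℕ∞) ≤ e.len)
    (h0 : P (e.state i))
    (hs : ∀ l, i ≤ l → l < m → (l : ℕ∞) < e.len → P (e.state l) → P (e.state (l + 1))) :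
    P (e.state m) := by
  induction m, him using Nat.le_induction with
  | base => exact h0
  | succ l hl ih =>
    have hlt : (l : ℕ∞) < e.len := lt_of_lt_of_le (by exact_mod_cast Nat.lt_succ_self l) hm
    exact hs l hl (Nat.lt_succ_self l) hlt
      (ih hlt.le fun k hk hkl => hs k hk (hkl.trans (Nat.lt_succ_self l)))

theorem progress {i m : ℕ} (him : i ≤ m) (hm : (m : ℕ∞) ≤ e.len) :
    (e.state i).Progress (e.state m) :=
  e.invariant (P := (e.state i).Progress) him hm
    ⟨fun _ => .refl _, fun _ => .refl _, fun _ => le_rfl⟩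
    fun l _ _ hl h => h.trans (e.step l hl).progress

theorem control {m : ℕ} (hm : (m : ℕ∞) ≤ e.len) : (e.state m).Control :=
  e.invariant (Nat.zero_le m) hm (e.state_zero ▸ State.control_start w₀)
    fun l _ _ hl h => (e.step l hl).control h

/-- The operation `i` is a write of `v` by `w`, and its tag is `t`. -/
def Writes (i : ℕ) (w : W) (v : V) (t : Tag W) : Prop :=
  (i : ℕ∞) < e.len ∧ e.act i = .invokeWrite w v ∧ ∃ (m : ℕ) (acks : _), (m : ℕ∞) ≤ e.len ∧
    (e.state m).writers w = ⟨((e.state i).writers w).q + 1, .putData t acks⟩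

/-- The operation `i` is a read by `r`, and it has selected the value `v` with tag `t`. -/
def Reads (i : ℕ) (r : R) (t : Tag W) (v : V) : Prop :=
  (i : ℕ∞) < e.len ∧ e.act i = .invokeRead r ∧ ∃ (m : ℕ) (acks : _), (m : ℕ∞) ≤ e.len ∧
    (e.state m).readers r = ⟨((e.state i).readers r).q + 1, .putTag t v acks⟩

variable {e}

/-- The action at `i` fixes writer and value; `Progress` between the two witnessing times fixes the
tag, as both have the same operation number. -/
theorem Writes.unique {i : ℕ} {w w' : W} {v v' : V} {t t' : Tag W} (h : e.Writes i w v t)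
    (h' : e.Writes i w' v' t') : w = w' ∧ v = v' ∧ t = t' := by
  obtain ⟨-, ha, m, acks, hm, hs⟩ := h
  obtain ⟨-, ha', m', acks', hm', hs'⟩ := h'
  obtain ⟨rfl, rfl⟩ : w = w' ∧ v = v' := by simpa [ha] using ha'
  refine ⟨rfl, rfl, ?_⟩
  wlog hle : m ≤ m' generalizing m m' t t' acks acks'
  · exact (this m' acks' hm' hs' m acks hm hs (by omega)).symm
  have hp := (e.progress hle hm').writer w
  rw [hs, hs'] at hp
  rcases hp with hp | ⟨-, -, hp⟩
  · simp at hp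
  · have := hp t acks rfl
    simp at this
    exact this.symm

theorem Reads.unique {i : ℕ} {r r' : R} {v v' : V} {t t' : Tag W} (h : e.Reads i r t v)
    (h' : e.Reads i r' t' v') : t = t' ∧ v = v' := by
  obtain ⟨-, ha, m, acks, hm, hs⟩ := h
  obtain ⟨-, ha', m', acks', hm', hs'⟩ := h'
  obtain rfl : r = r' := by simpa [ha] using ha'
  wlog hle : m ≤ m' generalizing m m' t t' v v' acks acks'
  · exact (this m' acks' hm' hs' m acks hm hs (by omega)).imp Eq.symm Eq.symm
  have hp := (e.progress hle hm').reader r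
  rw [hs, hs'] at hp
  rcases hp with hp | ⟨-, -, hp⟩
  · simp at hp
  · have := hp t v acks rfl
    simp at this
    exact ⟨this.1.symm, this.2.symm⟩

theorem Writes.tag {i : ℕ} {w : W} {v : V} {t : Tag W} (h : e.Writes i w v t) :
    1 ≤ tagZ t ∧ tagW t = w := by
  obtain ⟨-, -, m, acks, hm, hs⟩ := h
  have := (e.control hm).writer w _ t acks hs
  exact ⟨this.1, this.2.1⟩

theorem Writes.tag₀_lt {i : ℕ} {w : W} {v : V} {t : Tag W} (h : e.Writes i w v t) :
    tag₀ w₀ < t := by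
  rw [Prod.Lex.lt_iff]
  exact .inl h.tag.1

/-- A quorum of edge servers has committed the tag `t`, or a larger one, at time `j`. -/
def Committed (e : Execution W R C w₀) (j : ℕ) (t : Tag W) : Prop :=
  ∃ S : Finset (Fin C.n₁), C.f₁ + C.k ≤ S.card ∧ ∀ l ∈ S, t ≤ ((e.state j).edges l).tc

/-- At time `j ≤ i` the operation number of the write has not been reached, so `WriteAfter` holds
trivially there and is carried forward to the time `m` at which the tag is visible. -/
theorem Committed.lt_of_writes {i j : ℕ} {T t : Tag W} {w : W} {v : V} (hT : e.Committed j T)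
    (hij : j ≤ i) (h : e.Writes i w v t) : T < t := by
  obtain ⟨S, hS, hc⟩ := hT
  obtain ⟨hi, ha, m, acks, hm, hs⟩ := h
  have hq := ((e.progress hij hi.le).writer w).q_le
  -- Otherwise the number at `m` would be at most that at `i`, but it is one larger.
  have hjm : j ≤ m := by
    by_contra! hlt
    have := ((e.progress hlt.le ((Nat.cast_le.2 hij).trans hi.le)).writer w).q_le
    rw [hs] at this
    simp only at this
    omega
  have hj : (j : ℕ∞) ≤ e.len := (Nat.cast_le.2 hij).trans hi.le
  refine (e.invariant (P := State.WriteAfter S T w (((e.state i).writers w).q + 1)) hjm hm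
    ((e.control hj).writeAfter hc (by omega)) fun l _ _ hl h => ?_).tag t acks hs
  exact (e.step l hl).writeAfter (e.control hl.le) hS h

theorem Committed.le_of_reads {i j : ℕ} {T t : Tag W} {r : R} {v : V} (hT : e.Committed j T)
    (hij : j ≤ i) (h : e.Reads i r t v) : T ≤ t := by
  obtain ⟨S, hS, hc⟩ := hT
  obtain ⟨hi, ha, m, acks, hm, hs⟩ := h
  have hq := ((e.progress hij hi.le).reader r).q_le
  have hjm : j ≤ m := by
    by_contra! hlt
    have := ((e.progress hlt.le ((Nat.cast_le.2 hij).trans hi.le)).reader r).q_le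
    rw [hs] at this
    simp only at this
    omega
  have hj : (j : ℕ∞) ≤ e.len := (Nat.cast_le.2 hij).trans hi.le
  refine (e.invariant (P := State.ReadAfter S T r (((e.state i).readers r).q + 1)) hjm hm
    ((e.control hj).readAfter hc (by omega)) fun l _ _ hl h => ?_).tag t v acks hs
  exact (e.step l hl).readAfter (e.control hl.le) hS h

theorem WellFormed.exists_responseAt (he : e.WellFormed) {c : W ⊕ R} {i i' : ℕ} (h : i < i')
    (hi' : (i' : ℕ∞) < e.len) (hc : (e.act i).Invokes c) (hc' : (e.act i').Invokes c) :
    ∃ j < i', e.ResponseAt i j := by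
  classical
  -- The first response is selected, since `ResponseAt` forbids earlier ones.
  have hex : ∃ j, i < j ∧ j < i' ∧ (e.act j).Responds c := he c i i' h hi' hc hc'
  obtain ⟨h1, h2, h3⟩ := Nat.find_spec hex
  refine ⟨Nat.find hex, h2, h1, lt_trans (by exact_mod_cast h2) hi', c, hc, h3, ?_⟩
  intro m hm hlt hr
  exact Nat.find_min hex hlt ⟨hm, hlt.trans h2, hr⟩

theorem WellFormed.not_invokes (he : e.WellFormed) {c : W ⊕ R} {i j l : ℕ}
    (hj : (j : ℕ∞) < e.len) (hc : (e.act i).Invokes c)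
    (hr : ∀ m, i < m → m < j → ¬ (e.act m).Responds c) (hl : i < l) (hlj : l < j) :
    ¬ (e.act l).Invokes c := by
  intro hc'
  obtain ⟨m, h1, h2, h3⟩ := he c i l hl (lt_trans (by exact_mod_cast hlj) hj) hc hc'
  exact hr m h1 (h2.trans hlj) h3

/-- Without another invocation before the response, the operation number stays that of `i`, so the
acknowledgements that permit the response belong to this write, and they form the committing quorum.
-/
theorem WellFormed.write_response (he : e.WellFormed) {i j : ℕ} (h : e.ResponseAt i j) {w : W}
    {v : V} (ha : e.act i = .invokeWrite w v) : ∃ t, e.Writes i w v t ∧ e.Committed j t := by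
  obtain ⟨hij, hj, c, hc, hcj, hr⟩ := h
  have hi : (i : ℕ∞) < e.len := lt_trans (by exact_mod_cast hij) hj
  obtain rfl : c = .inl w := by
    rcases c with w' | r
    · obtain ⟨v', hv'⟩ := hc
      simp only [ha, Action.invokeWrite.injEq] at hv'
      rw [hv'.1]
    · simp [Action.Invokes, ha] at hc
  have hq : ((e.state j).writers w).q = ((e.state i).writers w).q + 1 := by
    have hstep := e.step i hi
    rw [ha] at hstep
    refine e.invariant (P := fun s => (s.writers w).q = ((e.state i).writers w).q + 1)
      (i := i + 1) hij hj.le ?_ ?_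
    · rcases hstep.writer_q w with ⟨-, h⟩ | ⟨v, -, h⟩
      · exact absurd rfl (h v)
      · rw [h]
    · intro l hl hlj hlt h
      rcases (e.step l hlt).writer_q w with ⟨h', -⟩ | ⟨v, h', -⟩
      · rw [h', h]
      · exact absurd ⟨v, h'⟩ (he.not_invokes hj hc hr hl hlj)
  have hstep := e.step j hj
  rw [show e.act j = .respondWrite w from hcj] at hstep
  generalize hs' : e.state (j + 1) = s' at hstep
  cases hstep with
  | respondWrite _ q t acks hcr hs hacks =>
    refine ⟨t, ⟨hi, ha, j, acks, hj.le, ?_⟩, acks, hacks,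
      ((e.control hj.le).writer w q t acks hs).2.2⟩
    rw [hs] at hq ⊢
    simp only at hq
    rw [hq]

theorem WellFormed.read_response (he : e.WellFormed) {i j : ℕ} (h : e.ResponseAt i j) {r : R}
    (ha : e.act i = .invokeRead r) :
    ∃ t v, e.Reads i r t v ∧ e.Committed j t ∧ e.act j = .respondRead r v := by
  obtain ⟨hij, hj, c, hc, hcj, hr⟩ := h
  have hi : (i : ℕ∞) < e.len := lt_trans (by exact_mod_cast hij) hj
  obtain rfl : c = .inr r := by
    rcases c with w | r'
    · simp [Action.Invokes, ha] at hc
    · simp only [Action.Invokes, ha, Action.invokeRead.injEq] at hc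
      rw [hc]
  have hq : ((e.state j).readers r).q = ((e.state i).readers r).q + 1 := by
    refine e.invariant (P := fun s => (s.readers r).q = ((e.state i).readers r).q + 1)
      (i := i + 1) hij hj.le ?_ ?_
    · rcases (e.step i hi).reader_q r with ⟨-, h⟩ | ⟨-, h⟩
      · exact absurd ha h
      · rw [h]
    · intro l hl hlj hlt h
      rcases (e.step l hlt).reader_q r with ⟨h', -⟩ | ⟨h', -⟩
      · rw [h', h]
      · exact absurd h' (he.not_invokes hj hc hr hl hlj)
  obtain ⟨v, hv⟩ : ∃ v, e.act j = .respondRead r v := hcj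
  have hstep := e.step j hj
  rw [hv] at hstep
  generalize hs' : e.state (j + 1) = s' at hstep
  cases hstep with
  | respondRead _ q t _ acks hcr hs hacks =>
    refine ⟨t, v, ⟨hi, ha, j, acks, hj.le, ?_⟩, ⟨acks, hacks,
      (e.control hj.le).reader r q t v acks hs⟩, hv⟩
    rw [hs] at hq ⊢
    simp only at hq
    rw [hq]

/-- A tag contains its writer. Of two writes by one writer the earlier responds first, so its tag is
committed before the later is invoked, and the later tag is strictly larger. -/
theorem WellFormed.writes_inj (he : e.WellFormed) {i i' : ℕ} {w w' : W} {v v' : V} {t : Tag W}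
    (h : e.Writes i w v t) (h' : e.Writes i' w' v' t) : i = i' := by
  by_contra hne
  wlog hlt : i < i' generalizing i i' w w' v v'
  · exact this h' h (Ne.symm hne) (by omega)
  obtain rfl : w = w' := h.tag.2.symm.trans h'.tag.2
  obtain ⟨j, hj, hr⟩ := he.exists_responseAt (c := .inl w) hlt h'.1 ⟨v, h.2.1⟩ ⟨v', h'.2.1⟩
  obtain ⟨u, hu, hc⟩ := he.write_response hr h.2.1
  obtain ⟨-, -, rfl⟩ := hu.unique h
  exact lt_irrefl _ (hc.lt_of_writes hj.le h')

theorem exists_invoke_of_getTag {m : ℕ} (hm : (m : ℕ∞) ≤ e.len) {w : W} {q : ℕ} {v : V}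
    {resps : Fin C.n₁ → Option (Tag W)} (h : (e.state m).writers w = ⟨q, .getTag v resps⟩) :
    ∃ i : ℕ, (i : ℕ∞) < e.len ∧ e.act i = .invokeWrite w v ∧
      q = ((e.state i).writers w).q + 1 := by
  induction m generalizing q resps with
  | zero => simp [e.state_zero, State.start] at h
  | succ m ih =>
    have hlt : (m : ℕ∞) < e.len := lt_of_lt_of_le (by exact_mod_cast Nat.lt_succ_self m) hm
    rcases (e.step m hlt).getTag_eq h with ⟨resps', h'⟩ | ⟨h', hq⟩
    · exact ih hlt.le h'
    · exact ⟨m, hlt, h', hq⟩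

/-- The tag `t` belongs to the value `v`: the initial one, or the one written with this tag. -/
def HasValue (e : Execution W R C w₀) (t : Tag W) (v : V) : Prop :=
  (t = tag₀ w₀ ∧ v = C.v₀) ∨ ∃ i w, e.Writes i w v t

theorem WellFormed.hasValue_unique (he : e.WellFormed) (t : Tag W) (v v' : V)
    (h : e.HasValue t v) (h' : e.HasValue t v') : v = v' := by
  rcases h with ⟨rfl, rfl⟩ | ⟨i, w, hi⟩ <;> rcases h' with ⟨h1, h2⟩ | ⟨i', w', hi'⟩
  · exact h2.symm
  · exact absurd hi'.tag₀_lt (lt_irrefl _)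
  · exact absurd (h1 ▸ hi.tag₀_lt) (lt_irrefl _)
  · obtain rfl := he.writes_inj hi hi'
    exact (hi.unique hi').2.1

/-- `HasValue` refers to the whole execution, so it is a fixed assignment to which the step lemma
applies at every time. -/
theorem WellFormed.sound (he : e.WellFormed) {m : ℕ} (hm : (m : ℕ∞) ≤ e.len) :
    (e.state m).Sound e.HasValue := by
  refine e.invariant (P := State.Sound e.HasValue) (Nat.zero_le m) hm
    (e.state_zero ▸ State.sound_start (.inl ⟨rfl, rfl⟩)) fun l _ _ hl h => ?_
  refine (e.step l hl).sound he.hasValue_unique h fun w q v resps q' t acks h1 h2 => ?_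
  obtain ⟨i, hi, ha, hq⟩ := exists_invoke_of_getTag hl.le h1
  refine .inr ⟨i, w, hi, ha, l + 1, acks, ?_, ?_⟩
  · exact_mod_cast Order.add_one_le_of_lt hl
  -- The number can change only by an invocation, which would lead to `getTag`, not `putData`.
  · have hq' : q' = q := by
      rcases (e.step l hl).writer_q w with ⟨h3, -⟩ | ⟨v, -, h3⟩
      · simpa [h1, h2] using h3
      · simp [h2] at h3
    rw [h2, hq', hq]

theorem WellFormed.hasValue_of_reads (he : e.WellFormed) {i : ℕ} {r : R} {t : Tag W} {v : V}
    (h : e.Reads i r t v) : e.HasValue t v := by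
  obtain ⟨-, -, m, acks, hm, hs⟩ := h
  exact (he.sound hm).result r _ t v acks hs

end Execution

end LDS

namespace LDS

/-! ### Serialization points -/

/-- Real points for a set of natural numbers ordered by `key` with finite initial segments: they
respect the order, lie after their numbers, and lie before every `j` that exceeds the whole initial
segment. -/
theorem exists_serialization {K : Type*} [LinearOrder K] (Φ : Set ℕ) (key : ℕ → K)
    (hfin : ∀ i ∈ Φ, {l | l ∈ Φ ∧ key l ≤ key i}.Finite) :
    ∃ pt : ℕ → ℝ, (∀ i ∈ Φ, ∀ i' ∈ Φ, key i < key i' → pt i < pt i') ∧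
      (∀ i ∈ Φ, (i : ℝ) < pt i) ∧
      ∀ i ∈ Φ, ∀ j : ℕ, (∀ l ∈ Φ, key l ≤ key i → l < j) → pt i < j := by
  set A : ℕ → Set ℕ := fun i => {l | l ∈ Φ ∧ key l ≤ key i} with hA
  have hself : ∀ i ∈ Φ, i ∈ A i := fun i hi => ⟨hi, le_rfl⟩
  have hbdd : ∀ i ∈ Φ, BddAbove (A i) := fun i hi => (hfin i hi).bddAbove
  have hmem : ∀ i ∈ Φ, sSup (A i) ∈ A i := fun i hi => Nat.sSup_mem ⟨i, hself i hi⟩ (hbdd i hi)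
  -- The latest invocation in the initial segment, plus a fraction strictly between `0` and `1` for
  -- `i ∈ Φ`. The fraction grows with the size of the segment, separating points with equal suprema.
  refine ⟨fun i => (sSup (A i) : ℕ) + (1 - 1 / ((A i).ncard + 1 : ℝ)), ?_, ?_, ?_⟩
  · intro i hi i' hi' hlt
    have hsub : A i ⊂ A i' := by
      refine ⟨fun l hl => ⟨hl.1, hl.2.trans hlt.le⟩, fun h => ?_⟩
      exact hlt.not_ge (h (hself i' hi')).2
    have hcard : ((A i).ncard : ℝ) < (A i').ncard := by
      exact_mod_cast Set.ncard_lt_ncard hsub (hfin i' hi')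
    have hsup : ((sSup (A i) : ℕ) : ℝ) ≤ (sSup (A i') : ℕ) := by
      exact_mod_cast le_csSup (hbdd i' hi') (hsub.1 (hmem i hi))
    have : 1 / ((A i').ncard + 1 : ℝ) < 1 / ((A i).ncard + 1 : ℝ) :=
      one_div_lt_one_div_of_lt (by positivity) (by linarith)
    simp only
    linarith
  · intro i hi
    have hcard : (0 : ℝ) < (A i).ncard := by
      exact_mod_cast (Set.ncard_pos (hfin i hi)).2 ⟨i, hself i hi⟩
    have hsup : (i : ℝ) ≤ (sSup (A i) : ℕ) := by
      exact_mod_cast le_csSup (hbdd i hi) (hself i hi)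
    have : 1 / ((A i).ncard + 1 : ℝ) < 1 := by
      rw [div_lt_one (by positivity)]
      linarith
    simp only
    linarith
  · intro i hi j h
    have hj : ((sSup (A i) : ℕ) : ℝ) + 1 ≤ j := by
      exact_mod_cast h _ (hmem i hi).1 (hmem i hi).2
    have : 0 < 1 / ((A i).ncard + 1 : ℝ) := by positivity
    simp only
    linarith

variable {W R V F : Type*} [LinearOrder W] [DecidableEq R] {C : Config V F} {w₀ : W}

/-! ### The order of operations and atomicity -/

namespace Execution

/-- The operation `i` has the tag `t`. -/
def OpTag (e : Execution W R C w₀) (i : ℕ) (t : Tag W) : Prop :=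
  (∃ w v, e.Writes i w v t) ∨ ∃ r v, e.Reads i r t v

variable {e : Execution W R C w₀}

theorem Writes.isWrite {i : ℕ} {w : W} {v : V} {t : Tag W} (h : e.Writes i w v t) :
    e.IsWrite i v :=
  ⟨h.1, w, h.2.1⟩

theorem Reads.isRead {i : ℕ} {r : R} {v : V} {t : Tag W} (h : e.Reads i r t v) : e.IsRead i :=
  ⟨h.1, r, h.2.1⟩

theorem IsWrite.not_isRead {i : ℕ} {v : V} (h : e.IsWrite i v) : ¬ e.IsRead i := by
  rintro ⟨-, r, hr⟩
  obtain ⟨-, w, hw⟩ := h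
  simp [hw] at hr

theorem OpTag.unique {i : ℕ} {t t' : Tag W} (h : e.OpTag i t) (h' : e.OpTag i t') : t = t' := by
  rcases h with ⟨w, v, h⟩ | ⟨r, v, h⟩ <;> rcases h' with ⟨w', v', h'⟩ | ⟨r', v', h'⟩
  · exact (h.unique h').2.2
  · exact absurd h'.isRead h.isWrite.not_isRead
  · exact absurd h.isRead h'.isWrite.not_isRead
  · exact (h.unique h').1

theorem OpTag.writes {i : ℕ} {t : Tag W} {v : V} (h : e.OpTag i t) (hi : e.IsWrite i v) :
    ∃ w, e.Writes i w v t := by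
  rcases h with ⟨w, v', h⟩ | ⟨r, v', h⟩
  · obtain ⟨-, w', hw'⟩ := hi
    obtain ⟨rfl, rfl⟩ : w = w' ∧ v' = v := by simpa [h.2.1] using hw'
    exact ⟨w, h⟩
  · exact absurd h.isRead hi.not_isRead

theorem OpTag.reads {i : ℕ} {t : Tag W} (h : e.OpTag i t) (hi : e.IsRead i) :
    ∃ r v, e.Reads i r t v := by
  rcases h with ⟨w, v, h⟩ | h
  · exact absurd hi h.isWrite.not_isRead
  · exact h

theorem OpTag.isOp {i : ℕ} {t : Tag W} (h : e.OpTag i t) : e.IsRead i ∨ ∃ v, e.IsWrite i v := by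
  rcases h with ⟨w, v, h⟩ | ⟨r, v, h⟩
  · exact .inr ⟨v, h.isWrite⟩
  · exact .inl h.isRead

theorem WellFormed.exists_opTag (he : e.WellFormed) {i j : ℕ} (h : e.ResponseAt i j) :
    ∃ t, e.OpTag i t ∧ e.Committed j t := by
  have ⟨_, _, c, hc, _⟩ := h
  rcases c with w | r
  · obtain ⟨v, hv⟩ := hc
    obtain ⟨t, ht, htc⟩ := he.write_response h hv
    exact ⟨t, .inl ⟨w, v, ht⟩, htc⟩
  · obtain ⟨t, v, ht, htc, -⟩ := he.read_response h hc
    exact ⟨t, .inr ⟨r, v, ht⟩, htc⟩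

/-- The operations that take effect: the complete ones, and the writes whose tag is that of a
complete read. -/
def Effective (e : Execution W R C w₀) : Set ℕ :=
  {i | (∃ j, e.ResponseAt i j) ∨
    ∃ w v t, e.Writes i w v t ∧ ∃ l j r u, e.ResponseAt l j ∧ e.Reads l r t u}

/-- A possibly incomplete write is covered by the complete read with the same tag, whose write-back
commits it. -/
theorem WellFormed.effective_tag (he : e.WellFormed) {i : ℕ} (hi : i ∈ e.Effective) :
    ∃ t, e.OpTag i t ∧ ∃ j, e.Committed j t := by
  rcases hi with ⟨j, hj⟩ | ⟨w, v, t, ht, l, j, r, u, hl, hlt⟩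
  · obtain ⟨t, ht, htc⟩ := he.exists_opTag hj
    exact ⟨t, ht, j, htc⟩
  · obtain ⟨t', ht', htc⟩ := he.exists_opTag hl
    obtain rfl := ht'.unique (.inr ⟨r, u, hlt⟩)
    exact ⟨t', .inl ⟨w, v, ht⟩, j, htc⟩

open Classical in
/-- The tag of the operation `i`, if it has one. -/
noncomputable def opTag (e : Execution W R C w₀) (i : ℕ) : Tag W :=
  if h : ∃ t, e.OpTag i t then h.choose else tag₀ w₀

theorem OpTag.opTag_eq {i : ℕ} {t : Tag W} (h : e.OpTag i t) : e.opTag i = t := by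
  have hex : ∃ t, e.OpTag i t := ⟨t, h⟩
  rw [opTag, dif_pos hex]
  exact hex.choose_spec.unique h

open Classical in
/-- The position of an operation in the serialization: operations are ordered by tag, with the write
of a tag before the reads, and these in the order of invocation. -/
noncomputable def key (e : Execution W R C w₀) (i : ℕ) : Tag W ×ₗ ℕ ×ₗ ℕ :=
  toLex (e.opTag i, toLex (if e.IsRead i then 1 else 0, i))

theorem key_lt_of_tag {i l : ℕ} {t u : Tag W} (hi : e.OpTag i t) (hl : e.OpTag l u) (h : t < u) :
    e.key i < e.key l := by
  rw [key, key, hi.opTag_eq, hl.opTag_eq, Prod.Lex.toLex_lt_toLex]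
  exact .inl h

theorem tag_le_of_key {i l : ℕ} {t u : Tag W} (hi : e.OpTag i t) (hl : e.OpTag l u)
    (h : e.key i ≤ e.key l) : t ≤ u :=
  not_lt.1 fun hlt => h.not_gt (key_lt_of_tag hl hi hlt)

theorem key_lt_of_isRead {i l : ℕ} {t : Tag W} (hi : e.OpTag i t) (hl : e.OpTag l t)
    (hr : e.IsRead l) (h : i < l ∨ ¬ e.IsRead i) : e.key i < e.key l := by
  rw [key, key, hi.opTag_eq, hl.opTag_eq, Prod.Lex.toLex_lt_toLex]
  refine .inr ⟨rfl, ?_⟩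
  rw [Prod.Lex.toLex_lt_toLex, if_pos hr]
  by_cases hir : e.IsRead i
  · exact .inr ⟨if_pos hir, h.resolve_right (not_not.2 hir)⟩
  · exact .inl (by simp [hir])

theorem key_injective : Function.Injective e.key := by
  intro i l h
  have := congrArg (fun x => (ofLex (ofLex x).2).2) h
  simpa [key] using this

/-- An operation invoked after a quorum has committed the tag of `i` is serialized after `i`. -/
theorem Committed.key_lt {i j l : ℕ} {t u : Tag W} (hc : e.Committed j t) (hi : e.OpTag i t)
    (hl : e.OpTag l u) (hjl : j ≤ l) (hil : i < l) : e.key i < e.key l := by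
  rcases hl with ⟨w, v, h⟩ | ⟨r, v, h⟩
  · exact key_lt_of_tag hi (.inl ⟨w, v, h⟩) (hc.lt_of_writes hjl h)
  · rcases (hc.le_of_reads hjl h).lt_or_eq with hlt | rfl
    · exact key_lt_of_tag hi (.inr ⟨r, v, h⟩) hlt
    · exact key_lt_of_isRead hi (.inr ⟨r, v, h⟩) h.isRead (.inl hil)

/-- Once the tag of `i` is committed at `j`, effective operations invoked after both `i` and `j`
have larger keys. -/
theorem WellFormed.finite_key_le (he : e.WellFormed) {i : ℕ} (hi : i ∈ e.Effective) :
    {l | l ∈ e.Effective ∧ e.key l ≤ e.key i}.Finite := by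
  obtain ⟨t, ht, j, hj⟩ := he.effective_tag hi
  refine (Set.finite_Iic (max i j)).subset fun l hl => ?_
  by_contra hlt
  rw [Set.mem_Iic, not_le, max_lt_iff] at hlt
  obtain ⟨u, hu, -⟩ := he.effective_tag hl.1
  exact hl.2.not_gt (hj.key_lt ht hu hlt.2.le hlt.1)

/-- This places the serialization point before the response: everything ordered up to `i` was
invoked before `i` responded. -/
theorem WellFormed.lt_of_key_le (he : e.WellFormed) {i j l : ℕ} (h : e.ResponseAt i j)
    (hl : l ∈ e.Effective) (hkey : e.key l ≤ e.key i) : l < j := by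
  obtain ⟨t, ht, hc⟩ := he.exists_opTag h
  obtain ⟨u, hu, -⟩ := he.effective_tag hl
  by_contra! hjl
  exact hkey.not_gt (hc.key_lt ht hu hjl (h.1.trans_le hjl))

open Classical in
/-- The value returned by the operation `i`, if it is a read. -/
noncomputable def returnValue (e : Execution W R C w₀) (i : ℕ) : V :=
  if h : ∃ r t v, e.Reads i r t v then h.choose_spec.choose_spec.choose else C.v₀

theorem Reads.returnValue_eq {i : ℕ} {r : R} {t : Tag W} {v : V} (h : e.Reads i r t v) :
    e.returnValue i = v := by
  have hex : ∃ r t v, e.Reads i r t v := ⟨r, t, v, h⟩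
  rw [returnValue, dif_pos hex]
  exact (hex.choose_spec.choose_spec.choose_spec.unique h).2

theorem WellFormed.atomic (he : e.WellFormed) : e.Atomic := by
  obtain ⟨pt, hmono, hinv, hresp⟩ :=
    exists_serialization e.Effective e.key fun i hi => he.finite_key_le hi
  have hkey : ∀ i ∈ e.Effective, ∀ l ∈ e.Effective, pt i < pt l → e.key i < e.key l := by
    intro i hi l hl h
    by_contra! hle
    rcases hle.lt_or_eq with hlt | heq
    · exact h.not_gt (hmono l hl i hi hlt)
    · rw [key_injective heq] at h
      exact lt_irrefl _ h
  refine ⟨e.Effective, pt, e.returnValue, ?_, fun i j h => .inl ⟨j, h⟩, ?_, hinv, ?_, ?_, ?_⟩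
  · intro i hi
    obtain ⟨t, ht, -⟩ := he.effective_tag hi
    exact ht.isOp
  · intro i hi l hl h
    by_contra hne
    rcases lt_or_gt_of_ne (key_injective.ne hne : e.key i ≠ e.key l) with hlt | hlt
    · exact (hmono i hi l hl hlt).ne h
    · exact (hmono l hl i hi hlt).ne h.symm
  · exact fun i j h => hresp i (.inl ⟨j, h⟩) j fun l hl hle => he.lt_of_key_le h hl hle
  · intro i j r v h hv
    have ⟨_, _, c, hc, hcj, _⟩ := h
    rcases c with w | r'
    · simp [Action.Responds, hv] at hcj
    · obtain ⟨t, v', ht, -, hv'⟩ := he.read_response h hc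
      rw [ht.returnValue_eq]
      rw [hv] at hv'
      simp only [Action.respondRead.injEq] at hv'
      exact hv'.2.symm
  · intro i hi hir
    obtain ⟨t, ht, -⟩ := he.effective_tag hi
    obtain ⟨r, v, hr⟩ := ht.reads hir
    -- Incomplete operations in `Effective` are writes, so a read there is complete.
    obtain ⟨j, hj⟩ : ∃ j, e.ResponseAt i j := by
      rcases hi with hi | ⟨w, v, t, hw, -⟩
      · exact hi
      · exact absurd hir hw.isWrite.not_isRead
    rw [hr.returnValue_eq]
    rcases he.hasValue_of_reads hr with ⟨rfl, rfl⟩ | ⟨m, w, hm⟩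
    · refine .inr ⟨fun m hm v hmv hlt => ?_, rfl⟩
      obtain ⟨u, hu, -⟩ := he.effective_tag hm
      obtain ⟨w, hw⟩ := hu.writes hmv
      -- For a read of the initial tag, a preceding write would have a tag at most `tag₀ w₀`.
      exact (tag_le_of_key hu ht (hkey m hm i hi hlt).le).not_gt hw.tag₀_lt
    · have hmt : e.OpTag m t := .inl ⟨w, v, hm⟩
      -- The second clause of `Effective` exists for this: the write may be incomplete, but the read
      -- `i` has returned its tag.
      have hmΦ : m ∈ e.Effective := .inr ⟨w, v, t, hm, i, j, r, v, hj, hr⟩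
      refine .inl ⟨m, hmΦ, hm.isWrite,
        hmono m hmΦ i hi (key_lt_of_isRead hmt ht hir (.inr hm.isWrite.not_isRead)), ?_⟩
      intro m' hm' v' hw' hlt
      obtain ⟨u, hu, -⟩ := he.effective_tag hm'
      obtain ⟨w', hm'w⟩ := hu.writes hw'
      by_contra! hlt'
      -- A write serialized between `m` and the read would have its tag squeezed to that of `m`,
      -- hence be `m` itself.
      have h1 := tag_le_of_key hu ht (hkey m' hm' i hi hlt).le
      have h2 := tag_le_of_key hmt hu (hkey m hmΦ m' hm' hlt').le
      obtain rfl := le_antisymm h1 h2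
      obtain rfl := he.writes_inj hm hm'w
      exact lt_irrefl _ hlt'

end Execution

end LDS

theorem theorem2 {W R V F : Type*} [LinearOrder W] [DecidableEq R] [Field F] [Finite F]
    (C : LDS.Config V F) (w₀ : W) (e : LDS.Execution W R C w₀) (he : e.WellFormed) :
    e.Atomic := by
  exact he.atomic
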